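/- Let $U\subset\mathbb C$ be a simply connected domain. Let $M_1,\dots,M_r\subset U$ be pairwise disjoint open sets covering $U$ up to a set of Lebesgue measure $0$, with characteristic functions $\chi_1,\dots,\chi_r$, let $A_1,\dots,A_r$ be pairwise distinct analytic functions in $U$, and let $\Phi=\sum_{i=1}^r A_i\chi_i$ a.e. in $U$. Assume that $\partial\Phi/\partial\bar z\ge 0$ in the sense of distributions in $U$. Let $p\in U$ be such that $p\in\overline{M_j}$ for $1\le j\le r$ and $A_j(p)\ne A_k(p)$ whenever $j\neq k$. Put $$H_j(z)=\mathrm{Re}\int_p^z A_j(w)\,dw,\qquad \varphi=\max_{1\le j\le r}H_j,\qquad W_j(p)=\{z\in U:\varphi(z)=H_j(z)\},$$ and let $K$ be the convex hull of $A_1(p),\dots,A_r(p)$. Let $A_i(p)$ be an extreme point of $K$, and let $\partial K_i$ be the union of the (closed) edges of $K$ that have $A_i(p)$ as an endpoint (if $K$ is a nondegenerate segment, its only edge is $K$ itself; if $K$ is a point, there are no edges). Suppose that the only points $A_k(p)$ with $k\ne i$ that lie on $\partial K_i$ are extreme points of $K$, i.e. the endpoints of these edges. Then the distributional derivative $\partial\varphi/\partial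 z$ in $U$ is a locally integrable function, and there is a neighborhood $N$ of $p$ such that $$\Phi=2\,\frac{\partial\varphi}{\partial z}\quad\text{a.e. in }W_i(p)\cap N.$$ -/

import Mathlib

open MeasureTheory TopologicalSpace Topology Set
open scoped Distributions LineDeriv

/-- The covering space of germs of primitives of `f` over `U`, with fibre the discrete space `D`
(a copy of `ℂ`), has a section. -/
theorem exists_primitive_aux {U : Set ℂ} (hU : IsOpen U) (hs : IsSimplyConnected U)
    {f : ℂ → ℂ} (hf : DifferentiableOn ℂ f U)
    (D : Type) [TopologicalSpace D] [DiscreteTopology D] (e : D ≃ ℂ) :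
    ∃ F : ℂ → ℂ, ∀ z ∈ U, HasDerivAt F (f z) z := by
  classical
  have h1 : ∀ x : U, ∃ B : Set ℂ, ∃ G : ℂ → ℂ, IsOpen B ∧ Convex ℝ B ∧ (x : ℂ) ∈ B ∧ B ⊆ U ∧
      ∀ z ∈ B, HasDerivAt G (f z) z := by
    intro x
    obtain ⟨r, hr, hB⟩ := Metric.isOpen_iff.mp hU x x.2
    obtain ⟨G, hG⟩ := (hf.mono hB).isExactOn_ball
    exact ⟨_, G, Metric.isOpen_ball, convex_ball _ _, Metric.mem_ball_self hr, hB, hG⟩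
  choose B G hBo hBc hxB hBU hG using h1
  have hconst : ∀ i j : U, ∃ c : ℂ, ∀ z ∈ B i ∩ B j, G i z - G j z = c := by
    intro i j
    refine ((hBo i).inter (hBo j)).exists_is_const_of_deriv_eq_zero
      ((hBc i).inter (hBc j)).isPreconnected ?_ ?_
    · intro z hz
      exact ((hG i z hz.1).sub (hG j z hz.2)).differentiableAt.differentiableWithinAt
    · intro z hz
      exact ((hG i z hz.1).sub (hG j z hz.2)).deriv.trans (sub_self _)
  have := hs.simplyConnectedSpace
  have := hU.locallyPathConnectedSpace
  let Z : FiberBundleCore U U D :=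
    { baseSet := fun i => {x : U | (x : ℂ) ∈ B i}
      isOpen_baseSet := fun i => (hBo i).preimage continuous_subtype_val
      indexAt := fun x => x
      mem_baseSet_at := fun x => hxB x
      coordChange := fun i j x v => e.symm (e v + G i x - G j x)
      coordChange_self := by intro i x _ v; simp
      continuousOn_coordChange := by
        intro i j
        obtain ⟨c, hc⟩ := hconst i j
        have h : Continuous fun q : U × D => e.symm (e q.2 + c) :=
          (continuous_of_discreteTopology (f := fun v : D => e.symm (e v + c))).comp continuous_snd
        refine h.continuousOn.congr ?_
        intro q hq
        simp [← hc q.1 hq.1, add_sub_assoc]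
      coordChange_comp := by intro i j k x _ v; simp }
  have cov : IsCoveringMap Z.proj := FiberBundle.isCoveringMap (F := D) (E := Z.Fiber)
  obtain ⟨x₀, hx₀⟩ := hs.nonempty
  obtain ⟨S, ⟨-, hS⟩, -⟩ := cov.existsUnique_continuousMap_lifts (ContinuousMap.id U)
    ⟨x₀, hx₀⟩ ⟨⟨x₀, hx₀⟩, e.symm 0⟩ rfl
  have hS' : ∀ z : U, (S z).1 = z := fun z => congrFun hS z
  let F : ℂ → ℂ := fun z => if h : z ∈ U then G ⟨z, h⟩ z + e (S ⟨z, h⟩).2 else 0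
  refine ⟨F, fun z hz => ?_⟩
  let z₀ : U := ⟨z, hz⟩
  have hF : ∀ w : U, (w : ℂ) ∈ B z₀ → F w = G z₀ w + e (Z.localTriv z₀ (S w)).2 := by
    intro w hw
    have : (Z.localTriv z₀ (S w)).2 = e.symm (e (S w).2 + G (S w).1 (S w).1 - G z₀ (S w).1) := rfl
    rw [this, hS' w]
    simp [F, add_comm]
  have hcont : ContinuousAt (fun w : U => (Z.localTriv z₀ (S w)).2) z₀ := by
    have h2 : ContinuousAt (Z.localTriv z₀) (S z₀) := by
      refine (Z.localTriv z₀).continuousAt ?_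
      rw [(Z.localTriv z₀).mem_source]
      have : (S z₀).proj = z₀ := hS' z₀
      show ((S z₀).proj : ℂ) ∈ B z₀
      rw [this]; exact hxB z₀
    exact continuous_snd.continuousAt.comp (h2.comp S.continuous.continuousAt)
  have hev : ∀ᶠ w : U in 𝓝 z₀, (Z.localTriv z₀ (S w)).2 = (Z.localTriv z₀ (S z₀)).2 := by
    have := hcont.tendsto
    rw [nhds_discrete D] at this
    exact Filter.tendsto_pure.mp this
  have hev2 : ∀ᶠ w in 𝓝 z, F w = G z₀ w + e (Z.localTriv z₀ (S z₀)).2 := by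
    have h3 := (hev.and (continuous_subtype_val.continuousAt.eventually
      ((hBo z₀).mem_nhds (hxB z₀))))
    have h4 := (hU.isOpenEmbedding_subtypeVal.map_nhds_eq z₀) ▸ (Filter.eventually_map
      (P := fun w => F w = G z₀ w + e (Z.localTriv z₀ (S z₀)).2) (m := Subtype.val)).mpr
      (h3.mono fun w hw => by rw [hF w hw.2, hw.1])
    exact h4
  exact ((hG z₀ z (hxB z₀)).add_const _).congr_of_eventuallyEq hev2

/-- Analytic functions on simply connected domains have primitives. -/
theorem exists_primitive {U : Set ℂ} (hU : IsOpen U) (hs : IsSimplyConnected U)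
    {f : ℂ → ℂ} (hf : DifferentiableOn ℂ f U) : Complex.IsExactOn f U := by
  obtain ⟨D, ⟨e⟩⟩ : ∃ D : Type, Nonempty (D ≃ ℂ) := ⟨ℂ, ⟨Equiv.refl ℂ⟩⟩
  let _ : TopologicalSpace D := ⊥
  have _ : DiscreteTopology D := ⟨rfl⟩
  exact exists_primitive_aux hU hs hf D e

/-- The integral `z ↦ ∫_p^z f(w) dw` of `f` in `U`: the primitive of `f` on `U` that vanishes
at `p`. It exists if `U` is a simply connected domain containing `p` and `f` is analytic in `U`
(see `primitiveFrom_spec`), and it is then unique on `U`. -/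
noncomputable def primitiveFrom (U : Opens ℂ) (p : ℂ) (f : ℂ → ℂ) : ℂ → ℂ :=
  open scoped Classical in
  if h : ∃ F : ℂ → ℂ, F p = 0 ∧ ∀ z ∈ U, HasDerivAt F (f z) z then h.choose else 0

theorem primitiveFrom_spec {U : Opens ℂ} (hs : IsSimplyConnected (U : Set ℂ)) (p : ℂ)
    {f : ℂ → ℂ} (hf : DifferentiableOn ℂ f U) :
    primitiveFrom U p f p = 0 ∧ ∀ z ∈ U, HasDerivAt (primitiveFrom U p f) (f z) z := by
  have h : ∃ F : ℂ → ℂ, F p = 0 ∧ ∀ z ∈ U, HasDerivAt F (f z) z :=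
    (exists_primitive U.isOpen hs hf).with_val_at p 0
  rw [primitiveFrom, dif_pos h]
  exact h.choose_spec

/-- The harmonic function `H(z) = Re ∫_p^z f(w) dw` in `U`. -/
noncomputable def harmonicFrom (U : Opens ℂ) (p : ℂ) (f : ℂ → ℂ) (z : ℂ) : ℝ :=
  (primitiveFrom U p f z).re

/-- `φ = max_j H_j`, where `H_j(z) = Re ∫_p^z A_j(w) dw`. -/
noncomputable def maxHarmonic {r : ℕ} (U : Opens ℂ) (p : ℂ) (A : Fin r → ℂ → ℂ) (z : ℂ) : ℝ :=
  ⨆ j, harmonicFrom U p (A j) z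

/-- `W_i(p)`: the set of points of `U` at which `φ = H_i`. -/
def maxRegion {r : ℕ} (U : Opens ℂ) (p : ℂ) (A : Fin r → ℂ → ℂ) (i : Fin r) : Set ℂ :=
  {z | z ∈ U ∧ maxHarmonic U p A z = harmonicFrom U p (A i) z}

/-- The distribution `ψ ↦ ∫ ψ f` on `U` defined by a locally integrable function `f`. -/
noncomputable def distributionOf (U : Opens ℂ) (f : ℂ → ℂ) : 𝓓'(U, ℂ) :=
  TestFunction.integralAgainstBilinCLM (ContinuousLinearMap.lsmul ℝ ℝ) volume f

theorem distributionOf_apply {U : Opens ℂ} {f : ℂ → ℂ} (hf : LocallyIntegrableOn f U)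
    (ψ : 𝓓(U, ℝ)) : distributionOf U f ψ = ∫ z, ψ z • f z :=
  TestFunction.integralAgainstBilinCLM_eq_integral hf

/-- The derivative `∂T/∂z = (∂T/∂x - i ∂T/∂y) / 2` of a distribution. -/
noncomputable def distDz {U : Opens ℂ} (T : 𝓓'(U, ℂ)) : 𝓓'(U, ℂ) :=
  (1 / 2 : ℂ) • (∂_{(1 : ℂ)} T - Complex.I • ∂_{Complex.I} T)

/-- The derivative `∂T/∂z̄ = (∂T/∂x + i ∂T/∂y) / 2` of a distribution. -/
noncomputable def distDzbar {U : Opens ℂ} (T : 𝓓'(U, ℂ)) : 𝓓'(U, ℂ) :=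
  (1 / 2 : ℂ) • (∂_{(1 : ℂ)} T + Complex.I • ∂_{Complex.I} T)

/-- A distribution is `≥ 0` if its value at every nonnegative test function is a nonnegative
real number. -/
def IsNonnegDistribution {U : Opens ℂ} (T : 𝓓'(U, ℂ)) : Prop :=
  ∀ ψ : 𝓓(U, ℝ), (∀ z, 0 ≤ ψ z) → 0 ≤ (T ψ).re ∧ (T ψ).im = 0

/-- `Σ(U)`: the distributions `T` on `U` with `∂T/∂z̄ ≥ 0`. -/
def sigmaClass (U : Opens ℂ) : Set (𝓓'(U, ℂ)) :=
  {T | IsNonnegDistribution (distDzbar T)}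

/-- `Φ` is piecewise analytic in `U` with pieces `M_i` and branches `A_i`: the `M_i` are pairwise
disjoint open subsets of `U` covering `U` up to a Lebesgue null set, the `A_i` are pairwise
distinct analytic functions in `U`, and `Φ = ∑ A_i χ_{M_i}` a.e. in `U`. -/
structure IsPiecewiseAnalytic {r : ℕ} (U : Opens ℂ) (Φ : ℂ → ℂ) (M : Fin r → Set ℂ)
    (A : Fin r → ℂ → ℂ) : Prop where
  isOpen_piece : ∀ i, IsOpen (M i)
  piece_subset : ∀ i, M i ⊆ U
  disjoint_pieces : ∀ i j, i ≠ j → Disjoint (M i) (M j)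
  cover : volume ((U : Set ℂ) \ ⋃ i, M i) = 0
  analytic : ∀ i, AnalyticOnNhd ℂ (A i) U
  distinct : ∀ i j, i ≠ j → ¬ EqOn (A i) (A j) U
  ae_eq : ∀ᵐ z, z ∈ U → Φ z = ∑ i, (M i).indicator (A i) z

/-- `K`: the convex hull of the points `A_1(p), …, A_r(p)`. -/
def valueHull {r : ℕ} (A : Fin r → ℂ → ℂ) (p : ℂ) : Set ℂ :=
  convexHull ℝ (range fun j => A j p)

/-- The union of the (closed) edges of the convex polygon `K` that have `a` as an endpoint, where
an edge is a nondegenerate segment which is a face (an extreme subset) of `K`. -/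
def adjacentEdges (K : Set ℂ) (a : ℂ) : Set ℂ :=
  {w | ∃ b, b ≠ a ∧ IsExtreme ℝ K (segment ℝ a b) ∧ w ∈ segment ℝ a b}

/-! Near `p`, it suffices that around almost every point where `H_i` is maximal only the piece `M i`
is present: then `Φ = A i` there, while `2 ∂φ/∂z = A i` wherever `φ` is differentiable.

The engine is `OnlyPieceNear.propagate`. If `Re f ≥ 0`, positivity of `∂Φ/∂z̄` gives `Re ∫ 2∂̄f · Φ
≤ 0`; since `∫ 2∂̄f · A i = 0`, also `Re ∫ 2∂̄f · (Φ - A i) ≤ 0`. In a holomorphic chart `e` take `f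
= F ∘ e`, where `F` lives near `[0, 1]` and `2∂̄F = -d` with `d ≥ 0` real except near `0`, where `Φ
= A i` already (`exists_barrier`). If `Re ((A k - A i) conj e') < 0` along the segment for all `k ≠
i`, the integrand is nonnegative, hence zero a.e., and no other piece reaches the far end of the
segment, where `d > 0`.

The chart comes from `eventually_onlyPieceNear`. If bad points `z` approach `p` in a limiting
direction `v` with `H_k(z) < H_i(z)`, then `Re (v (A k p - A i p)) ≤ 0` for all `k`: a supporting
line of `K` at `A i p`. By the edge hypothesis at most one `j ≠ i` lies on it
(`eq_of_re_eq_zero_of_edges`). In the chart `e = ∫_p (A j - A i)` the inequality for this `j` along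
the segment from `0` to `e z` becomes `Re (e z) = H_j(z) - H_i(z) < 0`, so no limit is needed; for
the other `k` it is strict already in the limit.

Finally `φ` is locally Lipschitz, so Rademacher's theorem and integration by parts identify the
distributional derivative with the pointwise one. Where `φ` is differentiable, all maximal `H_j`
have the same `A j`; these values being distinct near `p`, ties there form a null set. -/

/-! ### The barrier function and its holomorphic pullback -/

theorem hasDerivAt_expNegInvGlue_const_mul {σ s : ℝ} (hσ : 0 < σ) (hs : 0 < s) :
    HasDerivAt (fun s => expNegInvGlue (σ * s)) ((σ * s ^ 2)⁻¹ * expNegInvGlue (σ * s)) s := by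
  have h := (expNegInvGlue.hasDerivAt_polynomial_eval_inv_mul 1 (σ * s)).comp s
    ((hasDerivAt_id s).const_mul σ)
  simp only [Polynomial.eval_one, one_mul, Polynomial.derivative_one, sub_zero, mul_one,
    Polynomial.eval_pow, Polynomial.eval_X] at h
  refine h.congr_deriv ?_
  field_simp

theorem hasDerivAt_expNegInvGlue_const_mul_of_nonpos {σ s : ℝ} (hσ : 0 < σ) (hs : s ≤ 0) :
    HasDerivAt (fun s => expNegInvGlue (σ * s)) 0 s := by
  have h := (expNegInvGlue.hasDerivAt_polynomial_eval_inv_mul 1 (σ * s)).comp s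
    ((hasDerivAt_id s).const_mul σ)
  simp only [Polynomial.eval_one, one_mul, Polynomial.derivative_one, sub_zero, mul_one,
    Polynomial.eval_pow, Polynomial.eval_X] at h
  refine h.congr_deriv ?_
  rw [expNegInvGlue.zero_of_nonpos (mul_nonpos_of_nonneg_of_nonpos hσ.le hs)]
  simp

/-- The first-order operator `2 ∂/∂z̄ = ∂/∂x + i ∂/∂y` on functions. -/
noncomputable def twoDbar (f : ℂ → ℂ) (z : ℂ) : ℂ :=
  fderiv ℝ f z 1 + Complex.I * fderiv ℝ f z Complex.I

/-- With `s = L - x - B y²` one has `2∂̄s = -(1 + 2Byi)`; the factor `1 - 2Byi` is its conjugate up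
to sign and makes the result real. -/
theorem twoDbar_parabolic {κ : ℝ → ℝ} {κ' L B : ℝ} {ζ : ℂ}
    (hκ : HasDerivAt κ κ' (L - ζ.re - B * ζ.im ^ 2)) :
    twoDbar (fun ζ : ℂ => (κ (L - ζ.re - B * ζ.im ^ 2) : ℂ) * (1 - 2 * B * ζ.im * Complex.I)) ζ
      = -((κ' * (1 + 4 * B ^ 2 * ζ.im ^ 2) - 2 * B * κ (L - ζ.re - B * ζ.im ^ 2) : ℝ) : ℂ) := by
  have hre : HasFDerivAt (fun ζ : ℂ => ζ.re) Complex.reCLM ζ := Complex.reCLM.hasFDerivAt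
  have him : HasFDerivAt (fun ζ : ℂ => ζ.im) Complex.imCLM ζ := Complex.imCLM.hasFDerivAt
  have h1 := hκ.comp_hasFDerivAt ζ ((hre.const_sub L).sub ((him.pow 2).const_mul B))
  have h2 := Complex.ofRealCLM.hasFDerivAt.comp ζ h1
  have h3 := (((Complex.ofRealCLM.hasFDerivAt.comp ζ him).const_mul (2 * B : ℂ)).mul_const
    Complex.I).const_sub 1
  have h4 := h2.mul h3
  have h5 : HasFDerivAt (fun ζ : ℂ => (κ (L - ζ.re - B * ζ.im ^ 2) : ℂ) *
    (1 - 2 * B * ζ.im * Complex.I)) _ ζ := h4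
  rw [twoDbar, h5.fderiv]
  apply Complex.ext <;>
  simp [pow_two] <;> ring

theorem exists_barrier {δ : ℝ} (hδ : 0 < δ) : ∃ F : ℂ → ℂ,
    ContDiff ℝ (⊤ : ℕ∞) F ∧ HasCompactSupport F ∧
    tsupport F ⊆ Metric.thickening δ (segment ℝ 0 1) ∧ (∀ ζ, 0 ≤ (F ζ).re) ∧
    (∀ ζ, δ ≤ ‖ζ‖ → ∃ d : ℝ, 0 ≤ d ∧ twoDbar F ζ = -(d : ℂ)) ∧
    ∀ᶠ ζ in 𝓝 1, ∃ d : ℝ, 0 < d ∧ twoDbar F ζ = -(d : ℂ) := by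
  set L : ℝ := 1 + δ / 4 with hL
  -- Chosen so that `B (δ/4)² = 1 + δ`, which confines the support to `|y| ≤ δ/4`.
  set B : ℝ := 16 * (1 + δ) / δ ^ 2 with hB
  have hBpos : 0 < B := by positivity
  -- For `0 < s ≤ L` this gives `κ' = κ / (σ s²) ≥ 4Bκ`, which beats the error term `2Bκ`.
  set σ : ℝ := (4 * B * L ^ 2)⁻¹ with hσ
  have hLpos : 0 < L := by positivity
  have hσpos : 0 < σ := by positivity
  set κ : ℝ → ℝ := fun s => expNegInvGlue (σ * s) with hκ
  have hκs : ContDiff ℝ (⊤ : ℕ∞) κ := expNegInvGlue.contDiff.comp (contDiff_const.mul contDiff_id)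
  -- The cutoff at the left end spoils the sign of `2∂̄F` only for `-δ/2 ≤ x ≤ 0`; the support there
  -- lies in the `δ`-disc around `0`.
  set χ : ℝ → ℝ := fun x => Real.smoothTransition ((x + δ / 2) / (δ / 2)) with hχ
  have hχs : ContDiff ℝ (⊤ : ℕ∞) χ :=
    Real.smoothTransition.contDiff.comp ((contDiff_id.add contDiff_const).div_const _)
  have hχ1 : ∀ x, 0 ≤ x → χ x = 1 := fun x hx =>
    Real.smoothTransition.one_of_one_le (by rw [le_div_iff₀ (by positivity)]; linarith)
  have hχ0 : ∀ x, x ≤ -(δ / 2) → χ x = 0 := fun x hx =>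
    Real.smoothTransition.zero_of_nonpos (div_nonpos_of_nonpos_of_nonneg (by linarith)
      (by positivity))
  set F₀ : ℂ → ℂ := fun ζ =>
    (κ (L - ζ.re - B * ζ.im ^ 2) : ℂ) * (1 - 2 * B * ζ.im * Complex.I) with hF₀
  have hre : ContDiff ℝ (⊤ : ℕ∞) (fun ζ : ℂ => ζ.re) := Complex.reCLM.contDiff
  have him : ContDiff ℝ (⊤ : ℕ∞) (fun ζ : ℂ => ζ.im) := Complex.imCLM.contDiff
  have hof : ContDiff ℝ (⊤ : ℕ∞) (fun x : ℝ => (x : ℂ)) := Complex.ofRealCLM.contDiff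
  have hF₀s : ContDiff ℝ (⊤ : ℕ∞) F₀ := by
    refine (hof.comp (hκs.comp ((contDiff_const.sub hre).sub (contDiff_const.mul (him.pow 2))))).mul
      (contDiff_const.sub ((contDiff_const.mul (hof.comp him)).mul contDiff_const))
  set F : ℂ → ℂ := fun ζ => (χ ζ.re : ℂ) * F₀ ζ with hF
  set R : Set ℂ := {ζ | -(δ / 2) ≤ ζ.re ∧ ζ.re ≤ L ∧ |ζ.im| ≤ δ / 4} with hR
  have hRc : IsClosed R := by
    refine (isClosed_le continuous_const Complex.continuous_re).inter
      ((isClosed_le Complex.continuous_re continuous_const).inter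
      (isClosed_le Complex.continuous_im.abs continuous_const))
  have hsupp : tsupport F ⊆ R := by
    refine closure_minimal (fun ζ hζ => ?_) hRc
    have h1 : -(δ / 2) < ζ.re := by
      by_contra! h
      exact hζ (by simp [hF, hχ0 _ h])
    have h2 : 0 < L - ζ.re - B * ζ.im ^ 2 := by
      by_contra! h
      refine hζ ?_
      have : κ (L - ζ.re - B * ζ.im ^ 2) = 0 :=
        expNegInvGlue.zero_of_nonpos (mul_nonpos_of_nonneg_of_nonpos hσpos.le h)
      simp [hF, hF₀, this]
    refine ⟨h1.le, by nlinarith [mul_nonneg hBpos.le (sq_nonneg ζ.im)], ?_⟩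
    refine abs_le_of_sq_le_sq ?_ (by positivity)
    have h3 : B * ζ.im ^ 2 ≤ B * (δ / 4) ^ 2 := by
      have : B * (δ / 4) ^ 2 = 1 + δ := by rw [hB]; field_simp; ring
      rw [this]; linarith
    exact le_of_mul_le_mul_left h3 hBpos
  have hdist : ∀ ζ ∈ R, ∀ t : ℝ, |ζ.re - t| ≤ δ / 2 → ‖ζ - t‖ < δ := by
    intro ζ hζ t ht
    calc ‖ζ - t‖ ≤ |(ζ - t).re| + |(ζ - t).im| := Complex.norm_le_abs_re_add_abs_im _
      _ ≤ δ / 2 + δ / 4 := by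
        gcongr
        · simpa using ht
        · simpa using hζ.2.2
      _ < δ := by linarith
  have hRt : R ⊆ Metric.thickening δ (segment ℝ 0 1) := by
    intro ζ hζ
    have hmem : ∀ t : ℝ, 0 ≤ t → t ≤ 1 → (t : ℂ) ∈ segment ℝ (0 : ℂ) 1 := fun t h0 h1 =>
      ⟨1 - t, t, by linarith, h0, by ring, by simp⟩
    rw [Metric.mem_thickening_iff]
    have h1 := hζ.1
    have h2 := hζ.2.1
    rcases le_total ζ.re 0 with h | h
    · exact ⟨(0 : ℝ), hmem 0 le_rfl zero_le_one, by
        rw [dist_eq_norm]; exact hdist ζ hζ 0 (abs_le.2 ⟨by linarith, by linarith⟩)⟩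
    rcases le_total ζ.re 1 with h' | h'
    · exact ⟨(ζ.re : ℝ), hmem _ h h', by
        rw [dist_eq_norm]; exact hdist ζ hζ _ (by simp; positivity)⟩
    · exact ⟨(1 : ℝ), hmem 1 zero_le_one le_rfl, by
        rw [dist_eq_norm]; exact hdist ζ hζ 1 (abs_le.2 ⟨by linarith, by linarith⟩)⟩
  have hRcpt : IsCompact R := by
    refine Metric.isCompact_of_isClosed_isBounded hRc ?_
    refine (Metric.isBounded_iff_subset_closedBall (0 : ℂ)).2 ⟨L + δ, fun ζ hζ => ?_⟩
    rw [mem_closedBall_zero_iff]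
    have : |ζ.re| ≤ L + δ / 2 := abs_le.2 ⟨by linarith [hζ.1], by linarith [hζ.2.1]⟩
    linarith [Complex.norm_le_abs_re_add_abs_im ζ, hζ.2.2]
  have hloc : ∀ ζ : ℂ, 0 < ζ.re → twoDbar F ζ = twoDbar F₀ ζ := by
    intro ζ hζ
    have : F =ᶠ[𝓝 ζ] F₀ := by
      filter_upwards [(isOpen_lt continuous_const Complex.continuous_re).mem_nhds hζ] with w hw
      have hw' : (0 : ℝ) < w.re := hw
      simp [hF, hχ1 _ hw'.le]
    rw [twoDbar, twoDbar, this.fderiv_eq]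
  have hpos : ∀ ζ : ℂ, 0 < ζ.re → 0 < L - ζ.re - B * ζ.im ^ 2 →
      ∃ d : ℝ, 0 < d ∧ twoDbar F ζ = -(d : ℂ) := by
    intro ζ hζ hs
    set s := L - ζ.re - B * ζ.im ^ 2 with hsdef
    refine ⟨_, ?_, (hloc ζ hζ).trans
      (twoDbar_parabolic (hasDerivAt_expNegInvGlue_const_mul hσpos hs))⟩
    have hκp : 0 < expNegInvGlue (σ * s) := expNegInvGlue.pos_of_pos (mul_pos hσpos hs)
    have hsL : s ≤ L := by
      have := mul_nonneg hBpos.le (sq_nonneg ζ.im)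
      linarith
    have h1 : 4 * B ≤ (σ * s ^ 2)⁻¹ := by
      rw [le_inv_comm₀ (by positivity) (by positivity)]
      calc σ * s ^ 2 ≤ σ * L ^ 2 := by gcongr
        _ = (4 * B)⁻¹ := by rw [hσ]; field_simp
    have h2 : 4 * B * 1 ≤ (σ * s ^ 2)⁻¹ * (1 + 4 * B ^ 2 * ζ.im ^ 2) := by
      refine mul_le_mul h1 ?_ zero_le_one (by positivity)
      have : 0 ≤ 4 * B ^ 2 * ζ.im ^ 2 := by positivity
      linarith
    show 0 < (σ * s ^ 2)⁻¹ * expNegInvGlue (σ * s) * (1 + 4 * B ^ 2 * ζ.im ^ 2) -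
      2 * B * expNegInvGlue (σ * s)
    have h3 : 0 < ((σ * s ^ 2)⁻¹ * (1 + 4 * B ^ 2 * ζ.im ^ 2) - 2 * B) * expNegInvGlue (σ * s) :=
      mul_pos (by linarith) hκp
    linarith
  refine ⟨F, (hof.comp (hχs.comp hre)).mul hF₀s, hRcpt.of_isClosed_subset (isClosed_tsupport _) hsupp,
    hsupp.trans hRt, ?_, ?_, ?_⟩
  · intro ζ
    have : (F ζ).re = χ ζ.re * κ (L - ζ.re - B * ζ.im ^ 2) := by simp [hF, hF₀]
    rw [this]
    exact mul_nonneg (Real.smoothTransition.nonneg _) (expNegInvGlue.nonneg _)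
  · intro ζ hζ
    rcases le_or_gt ζ.re 0 with h | h
    · have hζR : ζ ∉ tsupport F := by
        intro hm
        have hm' := hsupp hm
        have := hdist ζ hm' 0 (abs_le.2 ⟨by linarith [hm'.1], by linarith⟩)
        simp only [Complex.ofReal_zero, sub_zero] at this
        linarith
      refine ⟨0, le_rfl, ?_⟩
      have : fderiv ℝ F ζ = 0 := by
        by_contra hne
        exact hζR (support_fderiv_subset ℝ hne)
      simp [twoDbar, this]
    · rcases lt_or_ge 0 (L - ζ.re - B * ζ.im ^ 2) with hs | hs
      · obtain ⟨d, hd, hd'⟩ := hpos ζ h hs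
        exact ⟨d, hd.le, hd'⟩
      · refine ⟨0, le_rfl, ?_⟩
        rw [hloc ζ h, hF₀, twoDbar_parabolic (hasDerivAt_expNegInvGlue_const_mul_of_nonpos hσpos hs)]
        simp [expNegInvGlue.zero_of_nonpos (mul_nonpos_of_nonneg_of_nonpos hσpos.le hs)]
  · have h1 : ∀ᶠ ζ : ℂ in 𝓝 1, 0 < ζ.re :=
      (isOpen_lt continuous_const Complex.continuous_re).mem_nhds (by simp)
    have h2 : ∀ᶠ ζ : ℂ in 𝓝 1, 0 < L - ζ.re - B * ζ.im ^ 2 := by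
      refine (isOpen_lt continuous_const (f := fun _ => (0 : ℝ)) ?_).mem_nhds ?_
      · exact (continuous_const.sub Complex.continuous_re).sub
          (continuous_const.mul (Complex.continuous_im.pow 2))
      · simp [hL, hδ]
    filter_upwards [h1, h2] with ζ hζ hs using hpos ζ hζ hs

/-- For holomorphic `e` the chain rule has no `∂G/∂z` term, so `∂̄(G ∘ e)` is `conj e'` times `∂̄G`.
Compact support in the target allows extension by zero. -/
theorem exists_pullback (e : OpenPartialHomeomorph ℂ ℂ) (he : DifferentiableOn ℂ e e.source)
    {G : ℂ → ℂ} (hG : ContDiff ℝ (⊤ : ℕ∞) G) (hGc : HasCompactSupport G)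
    (hGt : tsupport G ⊆ e.target) : ∃ f : ℂ → ℂ, ContDiff ℝ (⊤ : ℕ∞) f ∧ HasCompactSupport f ∧
      tsupport f ⊆ e.source ∩ e ⁻¹' tsupport G ∧ (∀ z ∈ e.source, f z = G (e z)) ∧
      ∀ z ∈ e.source, twoDbar f z = starRingEnd ℂ (deriv e z) * twoDbar G (e z) := by
  set K : Set ℂ := e.symm '' tsupport G with hK
  have hKc : IsCompact K := hGc.isCompact.image_of_continuousOn (e.continuousOn_symm.mono hGt)
  have hKs : K ⊆ e.source := by
    rintro _ ⟨x, hx, rfl⟩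
    exact e.map_target (hGt hx)
  have hKe : K ⊆ e ⁻¹' tsupport G := by
    rintro _ ⟨x, hx, rfl⟩
    simpa [e.right_inv (hGt hx)] using hx
  set f : ℂ → ℂ := e.source.indicator (G ∘ e) with hf
  have hsub : tsupport f ⊆ K := by
    refine closure_minimal (fun z hz => ?_) hKc.isClosed
    have hzs : z ∈ e.source := mem_of_indicator_ne_zero hz
    refine ⟨e z, subset_tsupport _ ?_, e.left_inv hzs⟩
    rw [Function.mem_support, hf, indicator_of_mem hzs] at hz
    exact hz
  have hfe : ∀ z ∈ e.source, f =ᶠ[𝓝 z] G ∘ e := fun z hz => by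
    filter_upwards [e.open_source.mem_nhds hz] with w hw
    exact indicator_of_mem hw _
  have hes : ∀ z ∈ e.source, ContDiffAt ℝ (⊤ : ℕ∞) e z := fun z hz =>
    (((he.analyticAt (e.open_source.mem_nhds hz)).contDiffAt).restrict_scalars ℝ)
  refine ⟨f, ?_, hKc.of_isClosed_subset (isClosed_tsupport _) hsub,
    fun z hz => ⟨hKs (hsub hz), hKe (hsub hz)⟩, fun z hz => indicator_of_mem hz _, ?_⟩
  · rw [contDiff_iff_contDiffAt]
    intro z
    by_cases hz : z ∈ K
    · exact (hG.contDiffAt.comp z (hes z (hKs hz))).congr_of_eventuallyEq (hfe z (hKs hz))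
    · have : f =ᶠ[𝓝 z] fun _ => 0 := by
        filter_upwards [hKc.isClosed.isOpen_compl.mem_nhds hz] with w hw
        by_contra h
        exact hw (hsub (subset_tsupport _ h))
      exact contDiffAt_const.congr_of_eventuallyEq this
  · intro z hz
    have hd : HasDerivAt e (deriv e z) z :=
      (he.differentiableAt (e.open_source.mem_nhds hz)).hasDerivAt
    have h1 := ((hG.differentiable (by simp)).differentiableAt (x := e z)).hasFDerivAt.comp z
      (hd.hasFDerivAt.restrictScalars ℝ)
    have h2 : ∀ v : ℂ, fderiv ℝ f z v = fderiv ℝ G (e z) (deriv e z * v) := by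
      intro v
      rw [(hfe z hz).fderiv_eq, h1.fderiv]
      simp [mul_comm]
    have h3 : ∀ w : ℂ, fderiv ℝ G (e z) w =
        w.re * fderiv ℝ G (e z) 1 + w.im * fderiv ℝ G (e z) Complex.I := by
      intro w
      conv_lhs => rw [← Complex.re_add_im w]
      have : (w.re : ℂ) + w.im * Complex.I = w.re • (1 : ℂ) + w.im • Complex.I := by
        simp
      rw [this, map_add, map_smul, map_smul]
      simp
    rw [twoDbar, twoDbar, h2, h2, h3 (deriv e z * 1), h3 (deriv e z * Complex.I)]
    generalize fderiv ℝ G (e z) 1 = a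
    generalize fderiv ℝ G (e z) Complex.I = b
    have hc : starRingEnd ℂ (deriv e z) = (deriv e z).re - (deriv e z).im * Complex.I := by
      apply Complex.ext <;> simp
    rw [hc]
    simp
    linear_combination (deriv e z).im * b * (Complex.I_mul_I)

/-! ### Testing distributions with complex-valued functions -/

theorem TestFunction.lineDerivOp_apply_eq_fderiv {U : Opens ℂ} (ψ : 𝓓(U, ℝ)) (v z : ℂ) :
    ∂_{v} ψ z = fderiv ℝ ψ z v := by
  rw [TestFunction.lineDerivOp_eq_lineDerivCLM ℝ, TestFunction.lineDerivCLM_apply]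
  simpa using ((ψ.contDiff.differentiable (by simp)) z).lineDeriv_eq_fderiv

theorem exists_testFunction_eq_one {U : Opens ℂ} {K : Set ℂ} (hK : IsCompact K)
    (hKU : K ⊆ U) : ∃ θ : 𝓓(U, ℝ), (∀ z, 0 ≤ θ z) ∧ ∀ z ∈ K, θ z = 1 := by
  obtain ⟨V, hVo, hKV, hVU, hVc⟩ := exists_open_between_and_isCompact_closure hK U.isOpen hKU
  obtain ⟨f, hf, hr, hs, h1⟩ := exists_contMDiff_support_eq_eq_one_iff (n := ⊤)
    (modelWithCornersSelf ℝ ℂ) hVo hK.isClosed hKV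
  have hts : tsupport f = closure V := by rw [tsupport, hs]
  refine ⟨⟨f, hf.contDiff, ?_, ?_⟩, fun z => ?_, fun z hz => ?_⟩
  · exact (show IsCompact (tsupport f) from hts ▸ hVc)
  · exact hts ▸ hVU
  · exact (hr (mem_range_self z)).1
  · exact (h1 z).1 hz

theorem distDzbar_apply {U : Opens ℂ} (T : 𝓓'(U, ℂ)) (ψ : 𝓓(U, ℝ)) :
    distDzbar T ψ = -(1 / 2) * (T (∂_{(1 : ℂ)} ψ) + Complex.I * T (∂_{Complex.I} ψ)) := by
  have : distDzbar T ψ = (1 / 2 : ℂ) * (∂_{(1 : ℂ)} T ψ + Complex.I * ∂_{Complex.I} T ψ) := rfl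
  rw [this]
  simp
  ring

theorem distDz_apply {U : Opens ℂ} (T : 𝓓'(U, ℂ)) (ψ : 𝓓(U, ℝ)) :
    distDz T ψ = -(1 / 2) * (T (∂_{(1 : ℂ)} ψ) - Complex.I * T (∂_{Complex.I} ψ)) := by
  have : distDz T ψ = (1 / 2 : ℂ) * (∂_{(1 : ℂ)} T ψ - Complex.I * ∂_{Complex.I} T ψ) := rfl
  rw [this]
  simp
  ring

theorem TestFunction.integrable_smul {U : Opens ℂ} {Φ : ℂ → ℂ} (hΦ : LocallyIntegrableOn Φ U)
    (ψ : 𝓓(U, ℝ)) : Integrable fun z => (ψ z : ℂ) * Φ z := by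
  simpa using TestFunction.integrable_bilin (ContinuousLinearMap.lsmul ℝ ℝ) hΦ ψ

theorem integrable_fderiv_mul {U : Opens ℂ} {Φ : ℂ → ℂ} (hΦ : LocallyIntegrableOn Φ U)
    (ψ : 𝓓(U, ℝ)) (v : ℂ) : Integrable fun z => (fderiv ℝ ψ z v : ℂ) * Φ z := by
  simpa [TestFunction.lineDerivOp_apply_eq_fderiv] using
    TestFunction.integrable_smul hΦ (∂_{v} ψ)

theorem distributionOf_lineDerivOp {U : Opens ℂ} {Φ : ℂ → ℂ} (hΦ : LocallyIntegrableOn Φ U)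
    (ψ : 𝓓(U, ℝ)) (v : ℂ) :
    distributionOf U Φ (∂_{v} ψ) = ∫ z, (fderiv ℝ ψ z v : ℂ) * Φ z := by
  rw [distributionOf_apply hΦ]
  simp [TestFunction.lineDerivOp_apply_eq_fderiv]

/-- A real test function is the difference of the nonnegative functions `ψ + Cθ` and `Cθ`, with `θ`
a cutoff equal to `1` on the support of `ψ`. -/
theorem IsNonnegDistribution.im_eq_zero {U : Opens ℂ} {T : 𝓓'(U, ℂ)}
    (hT : IsNonnegDistribution T) (ψ : 𝓓(U, ℝ)) : (T ψ).im = 0 := by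
  obtain ⟨θ, hθ0, hθ1⟩ := exists_testFunction_eq_one ψ.hasCompactSupport ψ.tsupport_subset
  obtain ⟨C, hC⟩ := ψ.continuous.bounded_above_of_compact_support ψ.hasCompactSupport
  have hC0 : 0 ≤ C := (norm_nonneg _).trans (hC 0)
  have h1 : (T (C • θ)).im = 0 := (hT _ fun z => by simpa using mul_nonneg hC0 (hθ0 z)).2
  have h2 : (T (ψ + C • θ)).im = 0 := by
    refine (hT _ fun z => ?_).2
    by_cases hz : z ∈ tsupport ψ
    · have := (abs_le.1 (hC z)).1
      simp [hθ1 z hz]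
      linarith
    · simp [image_eq_zero_of_notMem_tsupport hz]
      exact mul_nonneg hC0 (hθ0 z)
  rw [map_add, Complex.add_im, h1, add_zero] at h2
  exact h2

theorem twoDbar_eq_re_add_im {f : ℂ → ℂ} {z : ℂ} (hf : DifferentiableAt ℝ f z) :
    twoDbar f z = (fderiv ℝ (fun z => (f z).re) z 1 + Complex.I *
      fderiv ℝ (fun z => (f z).re) z Complex.I) + Complex.I * (fderiv ℝ (fun z => (f z).im) z 1 +
      Complex.I * fderiv ℝ (fun z => (f z).im) z Complex.I) := by
  have h1 : fderiv ℝ (fun z => (f z).re) z = Complex.reCLM.comp (fderiv ℝ f z) :=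
    (Complex.reCLM.hasFDerivAt.comp z hf.hasFDerivAt).fderiv
  have h2 : fderiv ℝ (fun z => (f z).im) z = Complex.imCLM.comp (fderiv ℝ f z) :=
    (Complex.imCLM.hasFDerivAt.comp z hf.hasFDerivAt).fderiv
  rw [twoDbar, h1, h2]
  apply Complex.ext <;> simp
  ring

theorem integrable_twoDbar_mul {U : Opens ℂ} {Φ : ℂ → ℂ} (hΦ : LocallyIntegrableOn Φ U)
    (f : 𝓓(U, ℂ)) : Integrable fun z => twoDbar f z * Φ z := by
  have key := ((integrable_fderiv_mul hΦ (TestFunction.postcompCLM Complex.reCLM f) 1).add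
    ((integrable_fderiv_mul hΦ (TestFunction.postcompCLM Complex.reCLM f) Complex.I).const_mul
      Complex.I)).add
    (((integrable_fderiv_mul hΦ (TestFunction.postcompCLM Complex.imCLM f) 1).add
    ((integrable_fderiv_mul hΦ (TestFunction.postcompCLM Complex.imCLM f) Complex.I).const_mul
      Complex.I)).const_mul Complex.I)
  refine key.congr (Filter.Eventually.of_forall fun z => ?_)
  beta_reduce
  rw [twoDbar_eq_re_add_im ((f.contDiff.differentiable (by simp)) z)]
  simp only [Pi.add_apply, TestFunction.postcompCLM_apply, Function.comp_def, Complex.reCLM_apply,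
    Complex.imCLM_apply]
  ring

/-- For `f = a + ib` the integral is `-2 (T a + i T b)` with `T = ∂Φ/∂z̄`. As `T b` is real, it
contributes nothing to the real part, so only `Re f` needs a sign. -/
theorem re_integral_twoDbar_mul_nonpos {U : Opens ℂ} {Φ : ℂ → ℂ} (hΦ : LocallyIntegrableOn Φ U)
    (hS : distributionOf U Φ ∈ sigmaClass U) (f : 𝓓(U, ℂ)) (hf : ∀ z, 0 ≤ (f z).re) :
    (∫ z, twoDbar f z * Φ z).re ≤ 0 := by
  set a : 𝓓(U, ℝ) := TestFunction.postcompCLM Complex.reCLM f with ha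
  set b : 𝓓(U, ℝ) := TestFunction.postcompCLM Complex.imCLM f with hb
  have hS' : IsNonnegDistribution (distDzbar (distributionOf U Φ)) := hS
  have h1 := (hS' a hf).1
  have h2 := hS'.im_eq_zero b
  have e1 : ∀ z, twoDbar f z * Φ z = ((fderiv ℝ a z 1 : ℂ) * Φ z +
      Complex.I * ((fderiv ℝ a z Complex.I : ℂ) * Φ z)) + Complex.I *
      ((fderiv ℝ b z 1 : ℂ) * Φ z + Complex.I * ((fderiv ℝ b z Complex.I : ℂ) * Φ z)) := by
    intro z
    rw [twoDbar_eq_re_add_im ((f.contDiff.differentiable (by simp)) z)]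
    simp only [ha, hb, TestFunction.postcompCLM_apply, Function.comp_def, Complex.reCLM_apply,
      Complex.imCLM_apply]
    ring
  have e2 : ∫ z, twoDbar f z * Φ z = -2 * (distDzbar (distributionOf U Φ) a +
      Complex.I * distDzbar (distributionOf U Φ) b) := by
    have i1 := integrable_fderiv_mul hΦ a 1
    have i2 := (integrable_fderiv_mul hΦ a Complex.I).const_mul Complex.I
    have i3 := integrable_fderiv_mul hΦ b 1
    have i4 := (integrable_fderiv_mul hΦ b Complex.I).const_mul Complex.I
    have i12 : Integrable fun z => (fderiv ℝ a z 1 : ℂ) * Φ z +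
      Complex.I * ((fderiv ℝ a z Complex.I : ℂ) * Φ z) := i1.add i2
    have i34 : Integrable fun z => (fderiv ℝ b z 1 : ℂ) * Φ z +
      Complex.I * ((fderiv ℝ b z Complex.I : ℂ) * Φ z) := i3.add i4
    rw [distDzbar_apply, distDzbar_apply]
    simp only [distributionOf_lineDerivOp hΦ, e1]
    rw [integral_add i12 (i34.const_mul _), integral_add i1 i2,
      integral_const_mul, integral_const_mul, integral_add i3 i4, integral_const_mul]
    ring
  rw [e2]
  simp [h2]
  exact h1

/-- Integration by parts moves `∂̄` onto `A`, where the Cauchy-Riemann equations annihilate it. -/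
theorem integral_twoDbar_mul_eq_zero {U : Opens ℂ} {A : ℂ → ℂ} (hA : AnalyticOnNhd ℂ A U)
    (f : 𝓓(U, ℂ)) : ∫ z, twoDbar f z * A z = 0 := by
  have hAl : LocallyIntegrableOn A U := hA.continuousOn.locallyIntegrableOn U.isOpen.measurableSet
  have hA'l : LocallyIntegrableOn (deriv A) U :=
    hA.deriv.continuousOn.locallyIntegrableOn U.isOpen.measurableSet
  have hfd : Differentiable ℝ f := f.contDiff.differentiable (by simp)
  have hfc : ∀ v, Continuous fun z => fderiv ℝ f z v := fun v =>
    (f.contDiff.continuous_fderiv (by simp)).clm_apply continuous_const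
  have hmul : ∀ {g B : ℂ → ℂ}, Continuous g → tsupport g ⊆ tsupport f →
      LocallyIntegrableOn B U → Integrable fun z => B z * g z := by
    intro g B hg hgs hB
    have hgc : HasCompactSupport g := f.hasCompactSupport.of_isClosed_subset
      (isClosed_tsupport _) hgs
    rw [← integrableOn_iff_integrable_of_support_subset (s := tsupport g)]
    · exact (hB.integrableOn_compact_subset (hgs.trans f.tsupport_subset) hgc).mul_continuousOn
        hg.continuousOn hgc
    · intro z hz
      by_contra h
      exact hz (by simp [image_eq_zero_of_notMem_tsupport h])
  have hsub : ∀ v, tsupport (fun z => fderiv ℝ f z v) ⊆ tsupport f := fun v =>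
    tsupport_fderiv_apply_subset ℝ v
  have key : ∀ v : ℂ, ∫ z, A z * fderiv ℝ f z v = -∫ z, deriv A z * v * f z := by
    intro v
    refine integral_bilinear_hasLineDerivAt_right_eq_neg_left_of_integrable (v := v)
      (B := ContinuousLinearMap.mul ℝ ℂ) ?_ ?_ ?_ ?_ ?_
    · have := (hmul f.continuous subset_rfl hA'l).const_mul v
      refine this.congr (Filter.Eventually.of_forall fun z => ?_)
      simp; ring
    · exact hmul (hfc v) (hsub v) hAl
    · exact hmul f.continuous subset_rfl hAl
    · intro z hz
      have := ((hA z (f.tsupport_subset hz)).differentiableAt.hasDerivAt.hasFDerivAt.restrictScalars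
        ℝ).hasLineDerivAt v
      simpa [mul_comm] using this
    · intro z _
      exact (hfd z).hasFDerivAt.hasLineDerivAt v
  have e1 : ∀ z, twoDbar f z * A z =
      A z * fderiv ℝ f z 1 + Complex.I * (A z * fderiv ℝ f z Complex.I) := by
    intro z; rw [twoDbar]; ring
  simp only [e1]
  rw [integral_add (hmul (hfc 1) (hsub 1) hAl) ((hmul (hfc _) (hsub _) hAl).const_mul _),
    integral_const_mul, key, key, mul_neg, ← integral_const_mul, ← sub_eq_add_neg, ← neg_add',
    neg_eq_zero, ← integral_add]
  · rw [← integral_zero ℂ ℂ]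
    congr 1
    ext z
    linear_combination deriv A z * f z * Complex.I_mul_I
  · have := hmul f.continuous subset_rfl hA'l
    simpa using this
  · refine ((hmul f.continuous subset_rfl hA'l).const_mul (Complex.I * Complex.I)).congr
      (Filter.Eventually.of_forall fun z => ?_)
    simp only
    ring

/-! ### Propagation of a dominant branch -/

section

variable {r : ℕ} {U : Opens ℂ} {Φ : ℂ → ℂ} {M : Fin r → Set ℂ} {A : Fin r → ℂ → ℂ}

theorem IsPiecewiseAnalytic.ae_eq_of_mem (h : IsPiecewiseAnalytic U Φ M A) :
    ∀ᵐ z, ∀ k, z ∈ M k → Φ z = A k z := by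
  filter_upwards [h.ae_eq] with z hz k hk
  rw [hz (h.piece_subset k hk), Finset.sum_eq_single k]
  · exact indicator_of_mem hk _
  · intro j _ hj
    exact indicator_of_notMem (fun hzj => (h.disjoint_pieces j k hj).le_bot ⟨hzj, hk⟩) _
  · simp

theorem IsPiecewiseAnalytic.ae_mem_piece (h : IsPiecewiseAnalytic U Φ M A) :
    ∀ᵐ z, z ∈ U → ∃ k, z ∈ M k := by
  have : ∀ᵐ z, z ∉ (U : Set ℂ) \ ⋃ i, M i := measure_eq_zero_iff_ae_notMem.1 h.cover
  filter_upwards [this] with z hz hzU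
  by_contra hc
  exact hz ⟨hzU, by simpa using hc⟩

theorem IsPiecewiseAnalytic.locallyIntegrableOn (h : IsPiecewiseAnalytic U Φ M A) :
    LocallyIntegrableOn Φ U := by
  have hk : ∀ k, LocallyIntegrableOn ((M k).indicator (A k)) U := fun k z hz => by
    obtain ⟨s, hs, hi⟩ := ((h.analytic k).continuousOn.locallyIntegrableOn
      (μ := volume) U.isOpen.measurableSet) z hz
    exact ⟨s, hs, hi.indicator (h.isOpen_piece k).measurableSet⟩
  have hsum : LocallyIntegrableOn (fun z => ∑ k, (M k).indicator (A k) z) U := by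
    have : ∀ s : Finset (Fin r),
        LocallyIntegrableOn (fun z => ∑ k ∈ s, (M k).indicator (A k) z) U := by
      intro s
      induction s using Finset.cons_induction with
      | empty => simpa using locallyIntegrable_zero.locallyIntegrableOn _
      | cons a s ha ih =>
        simp only [Finset.sum_cons]
        exact (hk a).add ih
    exact this _
  intro z hz
  obtain ⟨s, hs, hi⟩ := hsum z hz
  refine ⟨s ∩ U, Filter.inter_mem hs self_mem_nhdsWithin, ?_⟩
  refine IntegrableOn.congr_fun_ae (hi.mono_set inter_subset_left) ?_
  have : ∀ᵐ w ∂volume.restrict (U : Set ℂ), Φ w = ∑ k, (M k).indicator (A k) w :=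
    (ae_restrict_iff' U.isOpen.measurableSet).2 h.ae_eq
  have hle : volume.restrict (s ∩ U) ≤ volume.restrict (U : Set ℂ) :=
    Measure.restrict_mono inter_subset_right le_rfl
  filter_upwards [ae_mono hle this] with w hw using hw.symm

/-- The condition that near `z` only the piece `M i` is present. -/
def OnlyPieceNear (M : Fin r → Set ℂ) (i : Fin r) (z : ℂ) : Prop :=
  ∀ᶠ w in 𝓝 z, ∀ k, k ≠ i → w ∉ M k

/-- In a chart `e`, the dominance of the branch `A i` propagates in the positive direction along
`[0, 1]`, provided that all the other branches are strictly smaller in this direction. -/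
theorem OnlyPieceNear.propagate (hPA : IsPiecewiseAnalytic U Φ M A)
    (hΦ : distributionOf U Φ ∈ sigmaClass U) {i : Fin r} (e : OpenPartialHomeomorph ℂ ℂ)
    (heU : e.source ⊆ U) (he : DifferentiableOn ℂ e e.source)
    (hseg : segment ℝ 0 1 ⊆ e.target) (h0 : OnlyPieceNear M i (e.symm 0))
    (hneg : ∀ x ∈ segment ℝ (0 : ℂ) 1, ∀ k, k ≠ i →
      ((A k (e.symm x) - A i (e.symm x)) * starRingEnd ℂ (deriv e (e.symm x))).re < 0) :
    OnlyPieceNear M i (e.symm 1) := by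
  have h0t : (0 : ℂ) ∈ e.target := hseg (left_mem_segment ℝ _ _)
  have h1t : (1 : ℂ) ∈ e.target := hseg (right_mem_segment ℝ _ _)
  have hcont : ∀ k, ContinuousOn (fun x => ((A k (e.symm x) - A i (e.symm x)) *
      starRingEnd ℂ (deriv e (e.symm x))).re) e.target := by
    intro k
    have hm : MapsTo e.symm e.target U := fun x hx => heU (e.map_target hx)
    have hA : ∀ k, ContinuousOn (fun x => A k (e.symm x)) e.target := fun k =>
      (hPA.analytic k).continuousOn.comp e.continuousOn_symm hm
    have hd : ContinuousOn (fun x => deriv e (e.symm x)) e.target :=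
      (he.deriv e.open_source).continuousOn.comp e.continuousOn_symm fun x hx => e.map_target hx
    exact Complex.continuous_re.comp_continuousOn
      (((hA k).sub (hA i)).mul (Complex.continuous_conj.comp_continuousOn hd))
  set O : Set ℂ := {x | x ∈ e.target ∧ ∀ k, k ≠ i → ((A k (e.symm x) - A i (e.symm x)) *
      starRingEnd ℂ (deriv e (e.symm x))).re < 0} with hO
  have hOo : IsOpen O := by
    rw [isOpen_iff_mem_nhds]
    rintro x ⟨hx, hx'⟩
    have h : ∀ᶠ y in 𝓝 x, ∀ k, k ≠ i → ((A k (e.symm y) - A i (e.symm y)) *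
        starRingEnd ℂ (deriv e (e.symm y))).re < 0 := by
      rw [Filter.eventually_all]
      intro k
      rw [Filter.eventually_imp_distrib_left]
      exact fun hk => ((hcont k).continuousAt (e.open_target.mem_nhds hx)).eventually
        (gt_mem_nhds (hx' k hk))
    filter_upwards [e.open_target.mem_nhds hx, h] with y hy hy' using ⟨hy, hy'⟩
  have hsegc : IsCompact (segment ℝ (0 : ℂ) 1) := by
    rw [segment_eq_image_lineMap]
    exact isCompact_Icc.image AffineMap.lineMap_continuous
  obtain ⟨δ₁, hδ₁, hth⟩ := hsegc.exists_thickening_subset_open hOo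
    fun x hx => ⟨hseg hx, hneg x hx⟩
  have hseed : ∀ᶠ x in 𝓝 (0 : ℂ), ∀ k, k ≠ i → e.symm x ∉ M k :=
    (e.continuousAt_symm h0t).eventually h0
  obtain ⟨δ₂, hδ₂, hball⟩ := Metric.eventually_nhds_iff.1 hseed
  set δ := min δ₁ δ₂ with hδdef
  have hδ : 0 < δ := lt_min hδ₁ hδ₂
  obtain ⟨F, hFs, hFc, hFt, hFre, hFd, hF1⟩ := exists_barrier hδ
  have hFO : tsupport F ⊆ O :=
    hFt.trans ((Metric.thickening_mono (min_le_left _ _) _).trans hth)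
  obtain ⟨f, hfs, hfc, hft, hfe, hfd⟩ := exists_pullback e he hFs hFc fun x hx => (hFO hx).1
  let ψ : 𝓓(U, ℂ) := ⟨f, hfs, hfc, fun z hz => heU (hft hz).1⟩
  have hψ : ∀ z, 0 ≤ (ψ z).re := by
    intro z
    change 0 ≤ (f z).re
    by_cases hz : z ∈ tsupport f
    · rw [hfe z (hft hz).1]; exact hFre _
    · simp [image_eq_zero_of_notMem_tsupport hz]
  have hI := integrable_twoDbar_mul hPA.locallyIntegrableOn ψ
  have hIA := integrable_twoDbar_mul
    ((hPA.analytic i).continuousOn.locallyIntegrableOn U.isOpen.measurableSet) ψ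
  have hle : ∫ z, (twoDbar f z * (Φ z - A i z)).re ≤ 0 := by
    have e1 : ∀ z, twoDbar f z * (Φ z - A i z) = twoDbar ψ z * Φ z - twoDbar ψ z * A i z :=
      fun z => mul_sub _ _ _
    simp only [e1]
    have h2 : ∫ z, (twoDbar ψ z * Φ z - twoDbar ψ z * A i z).re =
        (∫ z, (twoDbar ψ z * Φ z - twoDbar ψ z * A i z)).re := integral_re (hI.sub hIA)
    rw [h2, integral_sub hI hIA, integral_twoDbar_mul_eq_zero (hPA.analytic i), sub_zero]
    exact re_integral_twoDbar_mul_nonpos hPA.locallyIntegrableOn hΦ ψ hψ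
  have hint : Integrable fun z => (twoDbar f z * (Φ z - A i z)).re := by
    have : (fun z => (twoDbar f z * (Φ z - A i z)).re) =
        fun z => RCLike.re (twoDbar ψ z * Φ z - twoDbar ψ z * A i z) := by
      ext z
      rw [← mul_sub]; rfl
    rw [this]
    exact (hI.sub hIA).re
  have hval : ∀ z ∈ e.source, ∀ k, ∀ d : ℝ, Φ z = A k z → twoDbar F (e z) = -(d : ℂ) →
      (twoDbar f z * (Φ z - A i z)).re =
        d * -((A k z - A i z) * starRingEnd ℂ (deriv e z)).re := by
    intro z hz k d h1 h2
    rw [hfd z hz, h1, h2, ← Complex.neg_re, ← Complex.re_ofReal_mul]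
    congr 1
    ring
  -- On `M i` the integrand vanishes. On another piece, `e z` is outside the seed disc, so `d ≥ 0`
  -- and the branch inequality gives the sign.
  have hnn : ∀ᵐ z, 0 ≤ (twoDbar f z * (Φ z - A i z)).re := by
    filter_upwards [hPA.ae_eq_of_mem, hPA.ae_mem_piece] with z hz1 hz2
    by_cases hz : z ∈ tsupport f
    · obtain ⟨hzs, hzt⟩ := hft hz
      obtain ⟨k, hk⟩ := hz2 (heU hzs)
      have hΦk := hz1 k hk
      rcases eq_or_ne k i with rfl | hki
      · simp [hΦk]
      have hzO := hFO hzt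
      have hnorm : δ ≤ ‖e z‖ := by
        by_contra! hlt
        refine hball (y := e z) ?_ k hki (by rwa [e.left_inv hzs])
        rw [dist_zero_right]
        exact hlt.trans_le (min_le_right _ _)
      obtain ⟨d, hd, hd'⟩ := hFd _ hnorm
      rw [hval z hzs k d hΦk hd']
      have := hzO.2 k hki
      rw [e.left_inv hzs] at this
      exact mul_nonneg hd (by linarith)
    · have : fderiv ℝ f z = 0 := by
        by_contra hne
        exact hz (support_fderiv_subset ℝ hne)
      simp [twoDbar, this]
  have hzero : ∀ᵐ z, (twoDbar f z * (Φ z - A i z)).re = 0 :=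
    (integral_eq_zero_iff_of_nonneg_ae hnn hint).1 (le_antisymm hle (integral_nonneg_of_ae hnn))
  have hs1 : e.symm 1 ∈ e.source := e.map_target h1t
  have hO1 : (1 : ℂ) ∈ O := ⟨h1t, hneg 1 (right_mem_segment ℝ _ _)⟩
  have hev : ∀ᶠ z in 𝓝 (e.symm 1), z ∈ e.source ∧ e z ∈ O ∧
      ∃ d : ℝ, 0 < d ∧ twoDbar F (e z) = -(d : ℂ) := by
    have hc : Filter.Tendsto e (𝓝 (e.symm 1)) (𝓝 1) := by
      simpa [e.right_inv h1t] using (e.continuousAt hs1).tendsto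
    exact (show ∀ᶠ z in 𝓝 _, z ∈ e.source from e.open_source.mem_nhds hs1).and
      ((hc.eventually (hOo.mem_nhds hO1)).and (hc.eventually hF1))
  obtain ⟨V, hVsub, hVo, hV1⟩ := mem_nhds_iff.1 hev
  filter_upwards [hVo.mem_nhds hV1] with w hwV k hki hwk
  -- Pieces are open, so meeting `V` at all means positive measure, where the integrand would be
  -- strictly positive.
  have hpos : 0 < volume (V ∩ M k) :=
    (hVo.inter (hPA.isOpen_piece k)).measure_pos volume ⟨w, hwV, hwk⟩
  refine hpos.ne' ?_
  rw [measure_eq_zero_iff_ae_notMem]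
  filter_upwards [hzero, hPA.ae_eq_of_mem] with z hz1 hz2 hz
  obtain ⟨hzs, hzO, d, hd, hd'⟩ := hVsub hz.1
  rw [hval z hzs k d (hz2 k hz.2) hd'] at hz1
  have := hzO.2 k hki
  rw [e.left_inv hzs] at this
  exact (mul_pos hd (by linarith : 0 < -((A k z - A i z) * starRingEnd ℂ (deriv e z)).re)).ne' hz1

/-- If `p` is in the closure of `M i`, then the dominance of the branch `A i` propagates from `p`
along straight segments in a chart `e` at `p`. -/
theorem onlyPieceNear_of_chart (hPA : IsPiecewiseAnalytic U Φ M A)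
    (hΦ : distributionOf U Φ ∈ sigmaClass U) {i : Fin r} (e : OpenPartialHomeomorph ℂ ℂ)
    (heU : e.source ⊆ U) (he : DifferentiableOn ℂ e e.source) {p β : ℂ} (hp : p ∈ e.source)
    (hp0 : e p = 0) (hpM : p ∈ closure (M i)) (hβ : β ≠ 0) (hseg : segment ℝ 0 β ⊆ e.target)
    (hneg : ∀ x ∈ segment ℝ 0 β, ∀ k, k ≠ i →
      (β * (A k (e.symm x) - A i (e.symm x)) * starRingEnd ℂ (deriv e (e.symm x))).re < 0) :
    OnlyPieceNear M i (e.symm β) := by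
  have hseg' : ∀ t ∈ Icc (0 : ℝ) 1, (t * β : ℂ) ∈ segment ℝ 0 β := fun t ht =>
    ⟨1 - t, t, by linarith [ht.2], ht.1, by ring, by simp⟩
  -- Since `p` is only in the closure of `M i`, the segment must start at a nearby `α = e q` with `q
  -- ∈ M i`; compactness keeps the strict inequalities under this perturbation.
  have hev : ∀ᶠ α in 𝓝 (0 : ℂ), ∀ t ∈ Icc (0 : ℝ) 1, α + t * (β - α) ∈ e.target ∧
      ∀ k, k ≠ i → ((β - α) * (A k (e.symm (α + t * (β - α))) - A i (e.symm (α + t * (β - α)))) *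
        starRingEnd ℂ (deriv e (e.symm (α + t * (β - α))))).re < 0 := by
    refine isCompact_Icc.eventually_forall_of_forall_eventually fun t ht => ?_
    have hc : ContinuousAt (fun q : ℂ × ℝ => q.1 + q.2 * (β - q.1)) (0, t) := by fun_prop
    have hx : (0 : ℂ) + t * (β - 0) ∈ e.target := by simpa using hseg (hseg' t ht)
    have ht' := hc.eventually (e.open_target.mem_nhds hx)
    refine ht'.and ?_
    rw [Filter.eventually_all]
    intro k
    rw [Filter.eventually_imp_distrib_left]
    intro hk
    have hs : ContinuousAt (fun q : ℂ × ℝ => e.symm (q.1 + q.2 * (β - q.1))) (0, t) :=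
      ContinuousAt.comp (f := fun q : ℂ × ℝ => q.1 + q.2 * (β - q.1)) (e.continuousAt_symm hx) hc
    have hsrc : e.symm ((0 : ℂ) + t * (β - 0)) ∈ e.source := e.map_target hx
    have hA : ∀ k, ContinuousAt (fun q : ℂ × ℝ => A k (e.symm (q.1 + q.2 * (β - q.1)))) (0, t) :=
      fun k => ContinuousAt.comp (f := fun q : ℂ × ℝ => e.symm (q.1 + q.2 * (β - q.1)))
        (hPA.analytic k _ (heU hsrc)).continuousAt hs
    have hd : ContinuousAt (fun q : ℂ × ℝ => deriv e (e.symm (q.1 + q.2 * (β - q.1)))) (0, t) :=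
      ContinuousAt.comp (f := fun q : ℂ × ℝ => e.symm (q.1 + q.2 * (β - q.1)))
        ((he.deriv e.open_source).continuousOn.continuousAt (e.open_source.mem_nhds hsrc)) hs
    have hall := Complex.continuous_re.continuousAt.comp
      (((continuousAt_const (y := β)).sub continuousAt_fst).mul ((hA k).sub (hA i)) |>.mul
        (Complex.continuous_conj.continuousAt.comp hd))
    refine hall.eventually (gt_mem_nhds ?_)
    simpa using hneg _ (hseg' t ht) k hk
  have hne : ∀ᶠ α in 𝓝 (0 : ℂ), α ≠ β := (isOpen_ne).mem_nhds hβ.symm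
  have hcp : Filter.Tendsto e (𝓝 p) (𝓝 0) := hp0 ▸ (e.continuousAt hp).tendsto
  obtain ⟨q, hqM, ⟨hqα, hqne⟩, hqs⟩ := (mem_closure_iff_frequently.1 hpM).and_eventually
    ((hcp.eventually (hev.and hne)).and (e.open_source.mem_nhds hp)) |>.exists
  set α := e q with hα
  have hβα : β - α ≠ 0 := sub_ne_zero.2 hqne.symm
  -- The affine map taking `α` to `0` and `β` to `1`. It multiplies `conj e'` by `conj (β - α)⁻¹`, a
  -- positive multiple of `β - α`.
  let T : ℂ ≃ₜ ℂ := (Homeomorph.subRight α).trans (Homeomorph.mulRight₀ (β - α)⁻¹ (inv_ne_zero hβα))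
  let e' : OpenPartialHomeomorph ℂ ℂ := e.transHomeomorph T
  have he'v : ∀ z, e' z = (e z - α) * (β - α)⁻¹ := fun z => rfl
  have he's : ∀ x, e'.symm x = e.symm (α + x * (β - α)) := by
    intro x
    change e.symm (T.symm x) = _
    congr 1
    rw [T.symm_apply_eq]
    change x = (α + x * (β - α) - α) * (β - α)⁻¹
    field_simp
    ring
  have he't : ∀ x, α + x * (β - α) ∈ e.target → x ∈ e'.target := by
    intro x hx
    change T.symm x ∈ e.target
    convert hx
    rw [T.symm_apply_eq]
    change x = (α + x * (β - α) - α) * (β - α)⁻¹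
    field_simp
    ring
  have hsegx : ∀ x ∈ segment ℝ (0 : ℂ) 1, ∃ t ∈ Icc (0 : ℝ) 1, x = t := by
    rintro x ⟨a, b, ha, hb, hab, rfl⟩
    exact ⟨b, ⟨hb, by linarith⟩, by simp⟩
  have hd' : ∀ z ∈ e.source, deriv e' z = deriv e z * (β - α)⁻¹ := by
    intro z hz
    have h1 : HasDerivAt e (deriv e z) z :=
      (he.differentiableAt (e.open_source.mem_nhds hz)).hasDerivAt
    exact ((h1.sub_const α).mul_const _).deriv
  have key := OnlyPieceNear.propagate hPA hΦ (i := i) e' heU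
    ((he.sub_const α).mul_const _) ?_ ?_ ?_
  · rw [he's] at key
    simpa using key
  · intro x hx
    obtain ⟨t, ht, rfl⟩ := hsegx x hx
    exact he't _ (hqα t ht).1
  · rw [he's]
    have : e.symm (α + 0 * (β - α)) = q := by simp [hα, e.left_inv hqs]
    rw [this]
    filter_upwards [(hPA.isOpen_piece i).mem_nhds hqM] with w hw k hk hwk
    exact (hPA.disjoint_pieces k i hk).le_bot ⟨hwk, hw⟩
  · intro x hx k hk
    obtain ⟨t, ht, rfl⟩ := hsegx x hx
    obtain ⟨h1, h2⟩ := hqα t ht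
    rw [he's, hd' _ (e.map_target h1)]
    have h3 := h2 k hk
    set a := A k (e.symm (α + t * (β - α))) - A i (e.symm (α + t * (β - α)))
    set b := starRingEnd ℂ (deriv e (e.symm (α + t * (β - α)))) with hb
    have hn : 0 < Complex.normSq (β - α) := Complex.normSq_pos.2 hβα
    have h4 : a * starRingEnd ℂ (deriv e (e.symm (α + t * (β - α))) * (β - α)⁻¹) =
        ((Complex.normSq (β - α))⁻¹ : ℝ) * ((β - α) * a * b) := by
      rw [map_mul, ← hb, map_inv₀, Complex.ofReal_inv, Complex.normSq_eq_conj_mul_self]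
      have : starRingEnd ℂ (β - α) ≠ 0 := (map_ne_zero _).2 hβα
      field_simp
    rw [h4, Complex.re_ofReal_mul]
    exact mul_neg_of_pos_of_neg (inv_pos.2 hn) h3

/-! ### Regularity and derivative of the maximum of the harmonic functions -/

theorem hasFDerivAt_harmonicFrom (hs : IsSimplyConnected (U : Set ℂ)) (p : ℂ) {f : ℂ → ℂ}
    (hf : DifferentiableOn ℂ f U) {z : ℂ} (hz : z ∈ U) :
    HasFDerivAt (harmonicFrom U p f)
      (Complex.reCLM.comp ((ContinuousLinearMap.toSpanSingleton ℂ (f z)).restrictScalars ℝ)) z :=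
  Complex.reCLM.hasFDerivAt.comp z
    (((primitiveFrom_spec hs p hf).2 z hz).hasFDerivAt.restrictScalars ℝ)

theorem contDiffAt_harmonicFrom (hs : IsSimplyConnected (U : Set ℂ)) (p : ℂ) {f : ℂ → ℂ}
    (hf : DifferentiableOn ℂ f U) {z : ℂ} (hz : z ∈ U) :
    ContDiffAt ℝ 1 (harmonicFrom U p f) z := by
  have h1 : DifferentiableOn ℂ (primitiveFrom U p f) U := fun w hw =>
    ((primitiveFrom_spec hs p hf).2 w hw).differentiableAt.differentiableWithinAt
  exact Complex.reCLM.contDiff.contDiffAt.comp z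
    (((h1.analyticAt (U.isOpen.mem_nhds hz)).contDiffAt).restrict_scalars ℝ)

theorem harmonicFrom_le_maxHarmonic (p : ℂ) (A : Fin r → ℂ → ℂ) (j : Fin r) (z : ℂ) :
    harmonicFrom U p (A j) z ≤ maxHarmonic U p A z :=
  le_ciSup (f := fun j => harmonicFrom U p (A j) z) (finite_range _).bddAbove j

theorem exists_maxHarmonic_eq [Nonempty (Fin r)] (p : ℂ) (A : Fin r → ℂ → ℂ) (z : ℂ) :
    ∃ j, maxHarmonic U p A z = harmonicFrom U p (A j) z := by
  obtain ⟨j, hj⟩ := exists_eq_ciSup_of_finite (f := fun j => harmonicFrom U p (A j) z)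
  exact ⟨j, hj.symm⟩

theorem continuousOn_maxHarmonic [Nonempty (Fin r)] (hs : IsSimplyConnected (U : Set ℂ)) (p : ℂ)
    (hA : ∀ j, DifferentiableOn ℂ (A j) U) : ContinuousOn (maxHarmonic U p A) U := by
  have : maxHarmonic U p A =
      fun z => Finset.univ.sup' Finset.univ_nonempty fun j => harmonicFrom U p (A j) z := by
    ext z
    exact (Finset.sup'_univ_eq_ciSup _).symm
  rw [this]
  exact ContinuousOn.finset_sup'_apply _ fun j _ z hz =>
    (contDiffAt_harmonicFrom hs p (hA j) hz).continuousAt.continuousWithinAt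

/-- The weight `θ ≥ 0` commutes with the maximum and makes each function globally Lipschitz, as
Rademacher's theorem and integration by parts require. -/
theorem exists_lipschitzWith_mul_maxHarmonic [Nonempty (Fin r)]
    (hs : IsSimplyConnected (U : Set ℂ)) (p : ℂ) (hA : ∀ j, DifferentiableOn ℂ (A j) U)
    (θ : 𝓓(U, ℝ)) (hθ : ∀ z, 0 ≤ θ z) :
    ∃ C, LipschitzWith C fun z => θ z * maxHarmonic U p A z := by
  have hj : ∀ j, ∃ C, LipschitzWith C fun z => θ z * harmonicFrom U p (A j) z := by
    intro j
    refine ContDiff.lipschitzWith_of_hasCompactSupport (𝕂 := ℝ) (n := 1)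
      (θ.hasCompactSupport.mul_right) ?_ one_ne_zero
    rw [contDiff_iff_contDiffAt]
    intro z
    by_cases hz : z ∈ tsupport θ
    · exact (θ.contDiff.contDiffAt.of_le (by exact_mod_cast le_top)).mul
        (contDiffAt_harmonicFrom hs p (hA j) (θ.tsupport_subset hz))
    · have : (fun z => θ z * harmonicFrom U p (A j) z) =ᶠ[𝓝 z] fun _ => 0 := by
        filter_upwards [(isClosed_tsupport θ).isOpen_compl.mem_nhds hz] with w hw
        rw [image_eq_zero_of_notMem_tsupport hw, zero_mul]
      exact contDiffAt_const.congr_of_eventuallyEq this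
  choose C hC using hj
  refine ⟨Finset.univ.sup C, LipschitzWith.of_le_add_mul _ fun x y => ?_⟩
  obtain ⟨j, hj⟩ := exists_maxHarmonic_eq (U := U) p A x
  rw [hj]
  calc θ x * harmonicFrom U p (A j) x
      ≤ θ y * harmonicFrom U p (A j) y + C j * dist x y := (hC j).le_add_mul x y
    _ ≤ _ := by
      gcongr
      · exact hθ y
      · exact harmonicFrom_le_maxHarmonic p A j y
      · exact Finset.le_sup (f := C) (Finset.mem_univ j)

theorem ae_differentiableAt_maxHarmonic [Nonempty (Fin r)]
    (hs : IsSimplyConnected (U : Set ℂ)) (p : ℂ) (hA : ∀ j, DifferentiableOn ℂ (A j) U)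
    {K : Set ℂ} (hK : IsCompact K) (hKU : K ⊆ U) :
    ∀ᵐ z, z ∈ interior K → DifferentiableAt ℝ (maxHarmonic U p A) z := by
  obtain ⟨θ, hθ0, hθ1⟩ := exists_testFunction_eq_one hK hKU
  obtain ⟨C, hC⟩ := exists_lipschitzWith_mul_maxHarmonic hs p hA θ hθ0
  filter_upwards [hC.ae_differentiableAt] with z hz hzK
  refine hz.congr_of_eventuallyEq ?_
  filter_upwards [isOpen_interior.mem_nhds hzK] with w hw
  rw [hθ1 w (interior_subset hw), one_mul]

/-- `φ - H_j ≥ 0` vanishes at `z`, so it has a minimum there and its derivative is zero. -/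
theorem fderiv_maxHarmonic_apply (hs : IsSimplyConnected (U : Set ℂ)) (p : ℂ)
    (hA : ∀ j, DifferentiableOn ℂ (A j) U) {z : ℂ} (hz : z ∈ U)
    (hd : DifferentiableAt ℝ (maxHarmonic U p A) z) {j : Fin r}
    (hj : maxHarmonic U p A z = harmonicFrom U p (A j) z) (v : ℂ) :
    fderiv ℝ (maxHarmonic U p A) z v = (A j z * v).re := by
  have h1 := hd.hasFDerivAt.sub (hasFDerivAt_harmonicFrom hs p (hA j) hz)
  have h2 : IsLocalMin (maxHarmonic U p A - harmonicFrom U p (A j)) z := by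
    refine Filter.Eventually.of_forall fun w => ?_
    simp only [Pi.sub_apply, hj, sub_self]
    exact sub_nonneg.2 (harmonicFrom_le_maxHarmonic p A j w)
  have h3 := DFunLike.congr_fun (h2.hasFDerivAt_eq_zero h1) v
  simp only [sub_apply, zero_apply, sub_eq_zero] at h3
  rw [h3]
  simp
  ring

theorem locallyIntegrableOn_fderiv_maxHarmonic [Nonempty (Fin r)]
    (hs : IsSimplyConnected (U : Set ℂ)) (p : ℂ) (hA : ∀ j, DifferentiableOn ℂ (A j) U) (v : ℂ) :
    LocallyIntegrableOn (fun z => fderiv ℝ (maxHarmonic U p A) z v) U := by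
  rw [locallyIntegrableOn_iff U.isOpen.isLocallyClosed]
  intro K hKU hK
  have hb : ∀ j, ∃ C, ∀ z ∈ K, ‖A j z‖ ≤ C := fun j =>
    hK.exists_bound_of_continuousOn ((hA j).continuousOn.mono hKU)
  choose C hC using hb
  refine Measure.integrableOn_of_bounded (M := (∑ j, |C j|) * ‖v‖) hK.measure_lt_top.ne
    (measurable_fderiv_apply_const ℝ _ v).aestronglyMeasurable ?_
  refine (ae_restrict_iff' hK.measurableSet).2 (Filter.Eventually.of_forall fun z hz => ?_)
  by_cases hd : DifferentiableAt ℝ (maxHarmonic U p A) z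
  · obtain ⟨j, hj⟩ := exists_maxHarmonic_eq (U := U) p A z
    rw [fderiv_maxHarmonic_apply hs p hA (hKU hz) hd hj v, Real.norm_eq_abs]
    calc |(A j z * v).re| ≤ ‖A j z * v‖ := Complex.abs_re_le_norm _
      _ = ‖A j z‖ * ‖v‖ := norm_mul _ _
      _ ≤ (∑ j, |C j|) * ‖v‖ := by
        gcongr
        exact ((hC j z hz).trans (le_abs_self _)).trans
          (Finset.single_le_sum (f := fun j => |C j|) (fun _ _ => abs_nonneg _)
            (Finset.mem_univ j))
  · rw [fderiv_zero_of_not_differentiableAt hd]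
    simp only [zero_apply, norm_zero]
    positivity

theorem integral_fderiv_maxHarmonic_mul [Nonempty (Fin r)]
    (hs : IsSimplyConnected (U : Set ℂ)) (p : ℂ) (hA : ∀ j, DifferentiableOn ℂ (A j) U)
    (ψ : 𝓓(U, ℝ)) (v : ℂ) :
    ∫ z, fderiv ℝ ψ z v * maxHarmonic U p A z =
      -∫ z, fderiv ℝ (maxHarmonic U p A) z v * ψ z := by
  obtain ⟨θ, hθ0, hθ1⟩ := exists_testFunction_eq_one ψ.hasCompactSupport ψ.tsupport_subset
  obtain ⟨C, hC⟩ := exists_lipschitzWith_mul_maxHarmonic hs p hA θ hθ0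
  obtain ⟨D, hD⟩ := ContDiff.lipschitzWith_of_hasCompactSupport (𝕂 := ℝ) ψ.hasCompactSupport
    ψ.contDiff (by simp)
  have key := LipschitzWith.integral_lineDeriv_mul_eq (μ := volume) hC hD ψ.hasCompactSupport v
  have e1 : ∀ z, lineDeriv ℝ (fun z => θ z * maxHarmonic U p A z) z v * ψ z =
      lineDeriv ℝ (maxHarmonic U p A) z v * ψ z := by
    intro z
    by_cases hz : ψ z = 0
    · simp [hz]
    have hev : (fun z => θ z * maxHarmonic U p A z) =ᶠ[𝓝 z] maxHarmonic U p A := by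
      filter_upwards [ψ.continuous.isOpen_support.mem_nhds hz] with w hw
      rw [hθ1 w (subset_tsupport _ hw), one_mul]
    rw [hev.lineDeriv_eq]
  have e2 : ∀ᵐ z, lineDeriv ℝ (fun z => θ z * maxHarmonic U p A z) z v * ψ z =
      fderiv ℝ (maxHarmonic U p A) z v * ψ z := by
    filter_upwards [ae_differentiableAt_maxHarmonic hs p hA ψ.hasCompactSupport ψ.tsupport_subset]
      with z hz
    by_cases hz0 : ψ z = 0
    · simp [hz0]
    rw [e1, (hz (interior_maximal (subset_tsupport _) ψ.continuous.isOpen_support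
      hz0)).lineDeriv_eq_fderiv]
  have e3 : ∀ z, lineDeriv ℝ ψ z (-v) * (θ z * maxHarmonic U p A z) =
      -(fderiv ℝ ψ z v * maxHarmonic U p A z) := by
    intro z
    rw [((ψ.contDiff.differentiable (by simp)) z).lineDeriv_eq_fderiv, map_neg]
    by_cases hz : z ∈ tsupport ψ
    · rw [hθ1 z hz]; ring
    · have : fderiv ℝ ψ z = 0 := by
        by_contra hne
        exact hz (support_fderiv_subset ℝ hne)
      simp [this]
  rw [integral_congr_ae e2] at key
  simp only [e3, integral_neg] at key
  rw [key, neg_neg]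

/-- The pointwise derivative `∂φ/∂z` of `φ = max_j H_j`. -/
noncomputable def maxHarmonicDz (U : Opens ℂ) (p : ℂ) (A : Fin r → ℂ → ℂ) (z : ℂ) : ℂ :=
  (1 / 2) * (fderiv ℝ (maxHarmonic U p A) z 1 -
    Complex.I * fderiv ℝ (maxHarmonic U p A) z Complex.I)

theorem locallyIntegrableOn_maxHarmonicDz [Nonempty (Fin r)]
    (hs : IsSimplyConnected (U : Set ℂ)) (p : ℂ) (hA : ∀ j, DifferentiableOn ℂ (A j) U) :
    LocallyIntegrableOn (maxHarmonicDz U p A) U := by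
  rw [locallyIntegrableOn_iff U.isOpen.isLocallyClosed]
  intro K hKU hK
  have h : ∀ v, IntegrableOn (fun z => (fderiv ℝ (maxHarmonic U p A) z v : ℂ)) K := fun v =>
    Integrable.ofReal ((locallyIntegrableOn_fderiv_maxHarmonic hs p hA v).integrableOn_compact_subset
      hKU hK)
  exact ((h 1).sub ((h Complex.I).const_mul Complex.I)).const_mul _

theorem two_mul_maxHarmonicDz (hs : IsSimplyConnected (U : Set ℂ)) (p : ℂ)
    (hA : ∀ j, DifferentiableOn ℂ (A j) U) {z : ℂ} (hz : z ∈ U)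
    (hd : DifferentiableAt ℝ (maxHarmonic U p A) z) {j : Fin r}
    (hj : maxHarmonic U p A z = harmonicFrom U p (A j) z) :
    2 * maxHarmonicDz U p A z = A j z := by
  rw [maxHarmonicDz, fderiv_maxHarmonic_apply hs p hA hz hd hj,
    fderiv_maxHarmonic_apply hs p hA hz hd hj]
  apply Complex.ext <;> simp

theorem distDz_maxHarmonic [Nonempty (Fin r)]
    (hs : IsSimplyConnected (U : Set ℂ)) (p : ℂ) (hA : ∀ j, DifferentiableOn ℂ (A j) U) :
    distDz (distributionOf U (fun z => (maxHarmonic U p A z : ℂ))) =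
      distributionOf U (maxHarmonicDz U p A) := by
  have hφ : LocallyIntegrableOn (fun z => (maxHarmonic U p A z : ℂ)) U :=
    (Complex.continuous_ofReal.comp_continuousOn
      (continuousOn_maxHarmonic hs p hA)).locallyIntegrableOn U.isOpen.measurableSet
  ext ψ
  rw [distDz_apply, distributionOf_lineDerivOp hφ, distributionOf_lineDerivOp hφ,
    distributionOf_apply (locallyIntegrableOn_maxHarmonicDz hs p hA)]
  have hint : ∀ v, Integrable fun z => ((fderiv ℝ (maxHarmonic U p A) z v * ψ z : ℝ) : ℂ) := by
    intro v
    have h1 : Integrable fun z => fderiv ℝ (maxHarmonic U p A) z v * ψ z := by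
      have := TestFunction.integrable_bilin (ContinuousLinearMap.lsmul ℝ ℝ)
        (locallyIntegrableOn_fderiv_maxHarmonic hs p hA v) ψ
      simpa [mul_comm] using this
    exact h1.ofReal
  have h : ∀ v, ∫ z, (fderiv ℝ ψ z v : ℂ) * maxHarmonic U p A z =
      -∫ z, ((fderiv ℝ (maxHarmonic U p A) z v * ψ z : ℝ) : ℂ) := by
    intro v
    rw [integral_complex_ofReal, ← Complex.ofReal_neg, ← integral_fderiv_maxHarmonic_mul hs p hA,
      ← integral_complex_ofReal]
    simp
  rw [h, h]
  have e : ∀ z, ψ z • maxHarmonicDz U p A z =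
      (1 / 2) * (((fderiv ℝ (maxHarmonic U p A) z 1 * ψ z : ℝ) : ℂ) -
      Complex.I * ((fderiv ℝ (maxHarmonic U p A) z Complex.I * ψ z : ℝ) : ℂ)) := by
    intro z
    rw [maxHarmonicDz, Complex.real_smul]
    push_cast
    ring
  simp only [e]
  rw [integral_const_mul, integral_sub (hint 1) ((hint _).const_mul _), integral_const_mul]
  ring

/-! ### Supporting lines and edges of the convex hull -/

theorem isExtreme_segment_of_re_le {K : Set ℂ} {a b e : ℂ} {s : Set ℂ} (hK : K = convexHull ℝ s)
    (ha : a ∈ s) (hb : b ∈ s) (hb0 : (e * (b - a)).re = 0)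
    (hs : ∀ x ∈ s, (e * (x - a)).re < 0 ∨ x ∈ segment ℝ a b) : IsExtreme ℝ K (segment ℝ a b) := by
  have hlin : ∀ x y : ℂ, ∀ α β : ℝ, α + β = 1 → (e * (α • x + β • y - a)).re =
      α * (e * (x - a)).re + β * (e * (y - a)).re := by
    intro x y α β hαβ
    have : α • x + β • y - a = α * (x - a) + β * (y - a) := by
      have h : (α : ℂ) + β = 1 := by exact_mod_cast hαβ
      simp only [Complex.real_smul]
      linear_combination a * h
    rw [this, mul_add, Complex.add_re, mul_left_comm, Complex.re_ofReal_mul, mul_left_comm,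
      Complex.re_ofReal_mul]
  have hseg : ∀ x ∈ segment ℝ a b, (e * (x - a)).re = 0 := by
    rintro x ⟨α, β, -, -, h, rfl⟩
    rw [hlin a b α β h, hb0]
    simp
  have hle : ∀ x, (e * (x - a)).re < 0 ∨ x ∈ segment ℝ a b → (e * (x - a)).re ≤ 0 :=
    fun x hx => hx.elim le_of_lt fun h => (hseg x h).le
  -- An open half-plane together with a segment of its boundary line is convex, so it contains `K`
  -- once it contains `s`.
  have hconv : Convex ℝ {x : ℂ | (e * (x - a)).re < 0 ∨ x ∈ segment ℝ a b} := by
    intro x hx y hy α β hα hβ hαβ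
    rcases hα.eq_or_lt with rfl | hα
    · rw [zero_add] at hαβ; simpa [hαβ] using hy
    rcases hβ.eq_or_lt with rfl | hβ
    · rw [add_zero] at hαβ; simpa [hαβ] using hx
    have hx' := hle x hx
    have hy' := hle y hy
    rcases hx with hx | hx
    · left; rw [hlin x y α β hαβ]; nlinarith
    rcases hy with hy | hy
    · left; rw [hlin x y α β hαβ]; nlinarith
    · exact Or.inr (convex_segment a b hx hy hα.le hβ.le hαβ)
  have hsub : K ⊆ {x : ℂ | (e * (x - a)).re < 0 ∨ x ∈ segment ℝ a b} :=
    hK ▸ convexHull_min hs hconv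
  refine ⟨?_, ?_⟩
  · rw [hK]
    exact (convex_convexHull ℝ s).segment_subset (subset_convexHull ℝ s ha)
      (subset_convexHull ℝ s hb)
  · rintro x hx y hy z hz ⟨α, β, hα, hβ, hαβ, rfl⟩
    have h0 := hseg _ hz
    rw [hlin x y α β hαβ] at h0
    have hy' := hle y (hsub hy)
    rcases hsub hx with h | h
    · nlinarith
    · exact h

/-- On the supporting line all other points lie on one side of the extreme point `a i`. The farthest
one, `a m`, spans an edge; any point strictly between would lie on that edge without being extreme.
-/
theorem eq_of_re_eq_zero_of_edges {ι : Type*} [Finite ι] {a : ι → ℂ} (ha : Function.Injective a)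
    {i : ι} (hi : a i ∈ (convexHull ℝ (range a)).extremePoints ℝ)
    (hedge : ∀ k, k ≠ i → a k ∈ adjacentEdges (convexHull ℝ (range a)) (a i) →
      a k ∈ (convexHull ℝ (range a)).extremePoints ℝ)
    {e : ℂ} (he : e ≠ 0) (hle : ∀ k, (e * (a k - a i)).re ≤ 0) {j k : ι} (hj : j ≠ i) (hk : k ≠ i)
    (hj0 : (e * (a j - a i)).re = 0) (hk0 : (e * (a k - a i)).re = 0) : j = k := by
  have hmem : ∀ l, a l ∈ convexHull ℝ (range a) := fun l => subset_convexHull ℝ _ (mem_range_self l)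
  set y : ι → ℝ := fun l => (e * (a l - a i)).im with hy
  have hval : ∀ l, (e * (a l - a i)).re = 0 → a l - a i = e⁻¹ * (y l * Complex.I) := by
    intro l hl
    rw [eq_inv_mul_iff_mul_eq₀ he]
    apply Complex.ext <;> simp [hy, hl] at *
  have hyj : y j ≠ 0 := by
    intro h
    have := hval j hj0
    rw [h] at this
    exact hj (ha (sub_eq_zero.1 (by simpa using this)))
  -- Coordinate on the supporting line with `a i` at `0` and `a j` at `1`.
  set τ : ι → ℝ := fun l => y l / y j with hτ
  have hτv : ∀ l, (e * (a l - a i)).re = 0 → a l = a i + τ l * (a j - a i) := by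
    intro l hl
    rw [← sub_eq_iff_eq_add', hval l hl, hval j hj0]
    have : (y j : ℂ) ≠ 0 := by exact_mod_cast hyj
    simp only [hτ]
    push_cast
    field_simp
  have hτpos : ∀ l, l ≠ i → (e * (a l - a i)).re = 0 → 0 < τ l := by
    intro l hli hl
    by_contra! hneg
    have hτ1 : 0 < 1 - τ l := by linarith
    rcases hneg.eq_or_lt with h0 | h0
    · have := hτv l hl
      rw [h0] at this
      exact hli (ha (by simpa using this))
    · have hop : a i ∈ openSegment ℝ (a j) (a l) := by
        refine ⟨-τ l / (1 - τ l), 1 / (1 - τ l), div_pos (by linarith) hτ1, by positivity,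
          by field_simp; ring, ?_⟩
        have hc : (1 - τ l : ℂ) ≠ 0 := by exact_mod_cast hτ1.ne'
        rw [hτv l hl]
        simp only [Complex.real_smul]
        push_cast
        field_simp
        ring
      exact hj (ha (hi.2 (hmem j) (hmem l) hop))
  obtain ⟨m, ⟨hmi, hm0⟩, hmax⟩ := Set.exists_max_image
    {l | l ≠ i ∧ (e * (a l - a i)).re = 0} τ (toFinite _) ⟨j, hj, hj0⟩
  have hmpos := hτpos m hmi hm0
  have hcm : (τ m : ℂ) ≠ 0 := by exact_mod_cast hmpos.ne'
  have hcomb : ∀ l, (e * (a l - a i)).re = 0 →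
      (1 - τ l / τ m) • a i + (τ l / τ m) • a m = a l := by
    intro l hl
    rw [hτv l hl, hτv m hm0]
    simp only [Complex.real_smul]
    push_cast
    field_simp
    ring
  have hext : IsExtreme ℝ (convexHull ℝ (range a)) (segment ℝ (a i) (a m)) := by
    refine isExtreme_segment_of_re_le rfl (mem_range_self i) (mem_range_self m) hm0 ?_
    rintro _ ⟨l, rfl⟩
    rcases (hle l).lt_or_eq with h | h
    · exact Or.inl h
    right
    rcases eq_or_ne l i with rfl | hli
    · exact left_mem_segment ℝ _ _
    have h1 : τ l / τ m ≤ 1 := (div_le_one hmpos).2 (hmax l ⟨hli, h⟩)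
    exact ⟨1 - τ l / τ m, τ l / τ m, by linarith, (div_pos (hτpos l hli h) hmpos).le, by ring,
      hcomb l h⟩
  have huniq : ∀ l, l ≠ i → (e * (a l - a i)).re = 0 → l = m := by
    intro l hli hl
    by_contra hlm
    have h1 : τ l / τ m < 1 := by
      refine lt_of_le_of_ne ((div_le_one hmpos).2 (hmax l ⟨hli, hl⟩)) fun h => hlm (ha ?_)
      rw [← hcomb l hl, h]
      simp
    have hop : a l ∈ openSegment ℝ (a i) (a m) :=
      ⟨1 - τ l / τ m, τ l / τ m, by linarith, div_pos (hτpos l hli hl) hmpos, by ring, hcomb l hl⟩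
    have hx := hedge l hli ⟨a m, fun h => hmi (ha h), hext, openSegment_subset_segment ℝ _ _ hop⟩
    exact hli (ha (hx.2 (hmem i) (hmem m) hop)).symm
  exact (huniq j hj hj0).trans (huniq k hk hk0).symm

/-! ### Directions of approach to `p` -/

theorem tendsto_div_norm_of_hasDerivAt {f : ℂ → ℂ} {f' p v : ℂ} (hf : HasDerivAt f f' p)
    (hf0 : f p = 0) {l : Filter ℂ} (hl : l ≤ 𝓝[≠] p)
    (hv : Filter.Tendsto (fun z => (z - p) / ‖z - p‖) l (𝓝 v)) :
    Filter.Tendsto (fun z => f z / ‖z - p‖) l (𝓝 (f' * v)) := by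
  have h1 := ((hasDerivAt_iff_tendsto_slope.1 hf).mono_left hl).mul hv
  refine h1.congr' ?_
  filter_upwards [hl self_mem_nhdsWithin] with z hz
  have hz' : z - p ≠ 0 := sub_ne_zero.2 hz
  rw [slope_def_field, hf0, sub_zero]
  field_simp

/-- Approaching `p` in the direction `v`, the branches whose value at `p` is smaller than that of
`A i` in the direction `v` are smaller than `A i` along segments in a chart at `p`. -/
theorem eventually_segment_re_neg (hA : ∀ k, AnalyticOnNhd ℂ (A k) U)
    (e : OpenPartialHomeomorph ℂ ℂ) (heU : e.source ⊆ U) (he : DifferentiableOn ℂ e e.source)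
    {p v : ℂ} (hp : p ∈ e.source) (hp0 : e p = 0) (he' : deriv e p ≠ 0) {l : Filter ℂ}
    (hl : l ≤ 𝓝[≠] p) (hv : Filter.Tendsto (fun z => (z - p) / ‖z - p‖) l (𝓝 v)) {i k : Fin r}
    (hk : (v * (A k p - A i p)).re < 0) :
    ∀ᶠ z in l, ∀ x ∈ segment ℝ 0 (e z),
      (e z * (A k (e.symm x) - A i (e.symm x)) * starRingEnd ℂ (deriv e (e.symm x))).re < 0 := by
  have h0t : (0 : ℂ) ∈ e.target := hp0 ▸ e.map_source hp
  have hs0 : e.symm 0 = p := by rw [← hp0, e.left_inv hp]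
  have hs : ContinuousAt (fun q : ℂ × ℂ => e.symm q.2) (deriv e p * v, 0) :=
    ContinuousAt.comp (f := fun q : ℂ × ℂ => q.2) (e.continuousAt_symm h0t) continuousAt_snd
  have hAc : ∀ k, ContinuousAt (fun q : ℂ × ℂ => A k (e.symm q.2)) (deriv e p * v, 0) := fun k =>
    ContinuousAt.comp (f := fun q : ℂ × ℂ => e.symm q.2) (by
      simpa only [hs0] using (hA k p (heU hp)).continuousAt) hs
  have hdc : ContinuousAt (fun q : ℂ × ℂ => deriv e (e.symm q.2)) (deriv e p * v, 0) :=
    ContinuousAt.comp (g := deriv e) (f := fun q : ℂ × ℂ => e.symm q.2) (by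
      simpa only [hs0] using
        (he.deriv e.open_source).continuousOn.continuousAt (e.open_source.mem_nhds hp)) hs
  have hall := Complex.continuous_re.continuousAt.comp
    ((continuousAt_fst.mul ((hAc k).sub (hAc i))).mul
      (Complex.continuous_conj.continuousAt.comp hdc))
  -- Since `e z / ‖z - p‖` tends to `e'(p) v`, the factor `conj e'(p)` leaves `|e'(p)|² v` in the
  -- limit.
  have hlim : (deriv e p * v * (A k p - A i p) * starRingEnd ℂ (deriv e p)).re < 0 := by
    have : deriv e p * v * (A k p - A i p) * starRingEnd ℂ (deriv e p) =
        (Complex.normSq (deriv e p) : ℝ) * (v * (A k p - A i p)) := by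
      rw [Complex.normSq_eq_conj_mul_self]; ring
    rw [this, Complex.re_ofReal_mul]
    exact mul_neg_of_pos_of_neg (Complex.normSq_pos.2 he') hk
  have hev := hall.eventually (gt_mem_nhds (a := 0) (by simpa [hs0] using hlim))
  rw [nhds_prod_eq, Filter.eventually_prod_iff] at hev
  obtain ⟨Q₁, hQ₁, Q₂, hQ₂, hQ⟩ := hev
  obtain ⟨ρ, hρ, hball⟩ := Metric.eventually_nhds_iff_ball.1 hQ₂
  have hd : HasDerivAt e (deriv e p) p :=
    (he.differentiableAt (e.open_source.mem_nhds hp)).hasDerivAt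
  have hle : l ≤ 𝓝 p := hl.trans nhdsWithin_le_nhds
  have h0 : Filter.Tendsto e l (𝓝 0) := by
    have := hd.continuousAt.tendsto.mono_left hle
    rwa [hp0] at this
  filter_upwards [(tendsto_div_norm_of_hasDerivAt hd hp0 hl hv).eventually hQ₁,
    h0.eventually (Metric.ball_mem_nhds 0 hρ), hl self_mem_nhdsWithin] with z hz1 hz2 hz3 x hx
  have hxb : x ∈ Metric.ball (0 : ℂ) ρ :=
    (convex_ball (0 : ℂ) ρ).segment_subset (Metric.mem_ball_self hρ) hz2 hx
  have hneg := hQ hz1 (hball x hxb)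
  have hn : 0 < ‖z - p‖ := norm_pos_iff.2 (sub_ne_zero.2 hz3)
  have hnc : (‖z - p‖ : ℂ) ≠ 0 := by exact_mod_cast hn.ne'
  have e1 : e z * (A k (e.symm x) - A i (e.symm x)) * starRingEnd ℂ (deriv e (e.symm x)) =
      (‖z - p‖ : ℝ) * (e z / ‖z - p‖ * (A k (e.symm x) - A i (e.symm x)) *
        starRingEnd ℂ (deriv e (e.symm x))) := by
    field_simp
  rw [e1, Complex.re_ofReal_mul]
  exact mul_neg_of_pos_of_neg hn hneg

theorem exists_chart_of_hasDerivAt {P D : ℂ → ℂ} (hP : ∀ z ∈ U, HasDerivAt P (D z) z) {p : ℂ}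
    (hp : p ∈ U) (hD : D p ≠ 0) : ∃ e : OpenPartialHomeomorph ℂ ℂ, e.source ⊆ U ∧ p ∈ e.source ∧
      (e : ℂ → ℂ) = P := by
  have hdiff : DifferentiableOn ℂ P U := fun z hz => (hP z hz).differentiableAt.differentiableWithinAt
  have hst : HasStrictDerivAt P (D p) p := by
    have := ((hdiff.analyticAt (U.isOpen.mem_nhds hp)).contDiffAt (n := 1)).hasStrictDerivAt
      one_ne_zero
    rwa [(hP p hp).deriv] at this
  let e₀ := (hst.hasStrictFDerivAt_equiv hD).toOpenPartialHomeomorph P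
  refine ⟨e₀.restrOpen U U.isOpen, ?_, ?_, rfl⟩
  · rw [OpenPartialHomeomorph.restrOpen_source]; exact inter_subset_right
  · rw [OpenPartialHomeomorph.restrOpen_source]
    exact ⟨(hst.hasStrictFDerivAt_equiv hD).mem_toOpenPartialHomeomorph_source, hp⟩

theorem eventually_onlyPieceNear (hU : IsSimplyConnected (U : Set ℂ))
    (hPA : IsPiecewiseAnalytic U Φ M A) (hΦ : distributionOf U Φ ∈ sigmaClass U)
    {p : ℂ} (hp : p ∈ U) {i : Fin r} (hactive : p ∈ closure (M i))
    (hdist : ∀ j k, j ≠ k → A j p ≠ A k p)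
    (hi : A i p ∈ (valueHull A p).extremePoints ℝ)
    (hedge : ∀ k, k ≠ i → A k p ∈ adjacentEdges (valueHull A p) (A i p) →
      A k p ∈ (valueHull A p).extremePoints ℝ) :
    ∀ᶠ z in 𝓝[≠] p, (∀ k, k ≠ i → harmonicFrom U p (A k) z < harmonicFrom U p (A i) z) →
      OnlyPieceNear M i z := by
  by_contra hcon
  rw [Filter.not_eventually] at hcon
  have hne : (𝓝[≠] p ⊓ Filter.principal {z | ¬((∀ k, k ≠ i →
      harmonicFrom U p (A k) z < harmonicFrom U p (A i) z) → OnlyPieceNear M i z)}).NeBot :=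
    Filter.frequently_mem_iff_neBot.1 hcon
  -- An ultrafilter of bad points plays the role of a subsequence: by compactness of the circle its
  -- directions converge.
  set l : Ultrafilter ℂ := Ultrafilter.of (𝓝[≠] p ⊓ Filter.principal {z | ¬((∀ k, k ≠ i →
      harmonicFrom U p (A k) z < harmonicFrom U p (A i) z) → OnlyPieceNear M i z)}) with hldef
  have hl : (l : Filter ℂ) ≤ 𝓝[≠] p := (Ultrafilter.of_le _).trans inf_le_left
  have hbad : ∀ᶠ z in (l : Filter ℂ), ¬((∀ k, k ≠ i →
      harmonicFrom U p (A k) z < harmonicFrom U p (A i) z) → OnlyPieceNear M i z) :=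
    Filter.le_principal_iff.1 ((Ultrafilter.of_le _).trans inf_le_right)
  obtain ⟨v, hvs, hv⟩ := (isCompact_sphere (0 : ℂ) 1).ultrafilter_le_nhds
    (l.map fun z => (z - p) / ‖z - p‖) (by
      rw [Filter.le_principal_iff]
      change ∀ᶠ z in (l : Filter ℂ), (z - p) / ‖z - p‖ ∈ Metric.sphere (0 : ℂ) 1
      filter_upwards [hl self_mem_nhdsWithin] with z hz
      have : ‖z - p‖ ≠ 0 := norm_ne_zero_iff.2 (sub_ne_zero.2 hz)
      simp [this])
  have hv : Filter.Tendsto (fun z => (z - p) / ‖z - p‖) (l : Filter ℂ) (𝓝 v) := hv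
  have hv0 : v ≠ 0 := by
    rintro rfl
    simp at hvs
  have hAd : ∀ k, DifferentiableOn ℂ (A k) U := fun k => (hPA.analytic k).differentiableOn
  set P : Fin r → ℂ → ℂ := fun k z => primitiveFrom U p (A k) z - primitiveFrom U p (A i) z with hP
  have hPd : ∀ k, ∀ z ∈ U, HasDerivAt (P k) (A k z - A i z) z := fun k z hz =>
    ((primitiveFrom_spec hU p (hAd k)).2 z hz).sub ((primitiveFrom_spec hU p (hAd i)).2 z hz)
  have hPp : ∀ k, P k p = 0 := fun k => by
    simp [hP, (primitiveFrom_spec hU p (hAd _)).1]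
  have hPre : ∀ k z, (P k z).re = harmonicFrom U p (A k) z - harmonicFrom U p (A i) z :=
    fun k z => rfl
  have hle : ∀ k, (v * (A k p - A i p)).re ≤ 0 := by
    intro k
    by_contra! hpos
    have ht := (Complex.continuous_re.tendsto _).comp
      (tendsto_div_norm_of_hasDerivAt (hPd k p hp) (hPp k) hl hv)
    rw [mul_comm] at hpos
    have hev := ht.eventually (lt_mem_nhds hpos)
    obtain ⟨z, hz1, hz2, hz3⟩ := (hbad.and (hev.and (hl self_mem_nhdsWithin))).exists
    rw [Classical.not_imp] at hz1
    have hki : k ≠ i := by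
      rintro rfl
      simp at hpos
    have h1 := hz1.1 k hki
    have h2 : 0 < (P k z).re / ‖z - p‖ := by
      have : (P k z / (‖z - p‖ : ℂ)).re = (P k z).re / ‖z - p‖ := Complex.div_ofReal_re _ _
      rw [← this]; exact hz2
    have h3 : 0 < (P k z).re := by
      by_contra! hneg
      exact absurd h2 (not_lt.2 (div_nonpos_of_nonpos_of_nonneg hneg (norm_nonneg _)))
    rw [hPre] at h3
    linarith
  by_cases hex : ∃ j, j ≠ i
  swap
  · push Not at hex
    obtain ⟨z, hz⟩ := hbad.exists
    exact hz fun _ => Filter.Eventually.of_forall fun w k hk => absurd (hex k) hk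
  -- If no branch is tied in the direction `v`, any `j ≠ i` can define the chart.
  obtain ⟨j, hji, hjk⟩ : ∃ j, j ≠ i ∧ ∀ k, k ≠ i → k ≠ j → (v * (A k p - A i p)).re < 0 := by
    by_cases h0 : ∃ j, j ≠ i ∧ (v * (A j p - A i p)).re = 0
    · obtain ⟨j, hji, hj0⟩ := h0
      refine ⟨j, hji, fun k hki hkj => lt_of_le_of_ne (hle k) fun hk0 => hkj ?_⟩
      exact eq_of_re_eq_zero_of_edges (a := fun k => A k p)
        (fun a b hab => by by_contra h; exact hdist a b h hab) hi hedge hv0 hle hki hji hk0 hj0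
    · push Not at h0
      obtain ⟨j, hji⟩ := hex
      exact ⟨j, hji, fun k hki _ => lt_of_le_of_ne (hle k) (h0 k hki)⟩
  have hDj : A j p - A i p ≠ 0 := sub_ne_zero.2 (hdist j i hji)
  obtain ⟨e, heU, hpe, heP⟩ := exists_chart_of_hasDerivAt (hPd j) hp hDj
  have hed : ∀ z ∈ U, deriv e z = A j z - A i z := fun z hz => by rw [heP]; exact (hPd j z hz).deriv
  have he : DifferentiableOn ℂ e e.source := fun z hz => by
    rw [heP]; exact (hPd j z (heU hz)).differentiableAt.differentiableWithinAt
  have hp0 : e p = 0 := by rw [heP]; exact hPp j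
  have he' : deriv e p ≠ 0 := by rwa [hed p hp]
  have hle' : (l : Filter ℂ) ≤ 𝓝 p := hl.trans nhdsWithin_le_nhds
  have hsmall : ∀ k, k ≠ i → k ≠ j → ∀ᶠ z in (l : Filter ℂ), ∀ x ∈ segment ℝ 0 (e z),
      (e z * (A k (e.symm x) - A i (e.symm x)) * starRingEnd ℂ (deriv e (e.symm x))).re < 0 :=
    fun k hki hkj => eventually_segment_re_neg hPA.analytic e heU he hpe hp0 he' hl hv
      (hjk k hki hkj)
  have hsmall' : ∀ᶠ z in (l : Filter ℂ), ∀ k, k ≠ i → k ≠ j → ∀ x ∈ segment ℝ 0 (e z),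
      (e z * (A k (e.symm x) - A i (e.symm x)) * starRingEnd ℂ (deriv e (e.symm x))).re < 0 := by
    rw [Filter.eventually_all]
    intro k
    rw [Filter.eventually_imp_distrib_left]
    intro hki
    rw [Filter.eventually_imp_distrib_left]
    exact hsmall k hki
  obtain ⟨ρ, hρ, hball⟩ := Metric.isOpen_iff.1 (e.open_target.inter
    (e.isOpen_inter_preimage_symm (hPA.analytic j |>.continuousOn.sub
      (hPA.analytic i).continuousOn |>.isOpen_inter_preimage U.isOpen isOpen_ne (t := {0}ᶜ)))) 0
    ⟨hp0 ▸ e.map_source hpe, hp0 ▸ e.map_source hpe, by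
      have : e.symm 0 = p := by rw [← hp0, e.left_inv hpe]
      rw [mem_preimage, this]
      exact ⟨hp, hDj⟩⟩
  have hez : ∀ᶠ z in (l : Filter ℂ), e z ∈ Metric.ball (0 : ℂ) ρ := by
    have := (e.continuousAt hpe).tendsto.mono_left hle'
    rw [hp0] at this
    exact this.eventually (Metric.ball_mem_nhds 0 hρ)
  obtain ⟨z, hz1, hz2, hz3, hz4⟩ := (hbad.and (hsmall'.and (hez.and
    (hle' (e.open_source.mem_nhds hpe))))).exists
  rw [Classical.not_imp] at hz1
  refine hz1.2 ?_
  have hre : (e z).re < 0 := by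
    rw [heP, hPre]; linarith [hz1.1 j hji]
  have hsegb : segment ℝ 0 (e z) ⊆ Metric.ball (0 : ℂ) ρ :=
    (convex_ball (0 : ℂ) ρ).segment_subset (Metric.mem_ball_self hρ) hz3
  have key := onlyPieceNear_of_chart hPA hΦ (i := i) e heU he hpe hp0 hactive (β := e z)
    (by intro h; rw [h] at hre; simp at hre) (fun x hx => (hball (hsegb hx)).1) ?_
  · rwa [e.left_inv hz4] at key
  · intro x hx k hki
    -- For the chart's own branch `e' = A j - A i`, so the expression is `|A j - A i|² e z`, whose
    -- sign is exact along the whole segment.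
    rcases eq_or_ne k j with rfl | hkj
    · obtain ⟨hxt, -, hxU, hxn⟩ := hball (hsegb hx)
      rw [hed _ hxU, mul_assoc, Complex.mul_conj, mul_comm, Complex.re_ofReal_mul]
      exact mul_neg_of_pos_of_neg (Complex.normSq_pos.2 hxn) hre
    · exact hz2 k hki hkj x hx

end

/-! ### Conclusion -/

theorem corollary5 {r : ℕ} (U : Opens ℂ) (hU : IsSimplyConnected (U : Set ℂ))
    (Φ : ℂ → ℂ) (M : Fin r → Set ℂ) (A : Fin r → ℂ → ℂ)
    (hPA : IsPiecewiseAnalytic U Φ M A) (hΦ : distributionOf U Φ ∈ sigmaClass U)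
    (p : ℂ) (hp : p ∈ U)
    (hactive : ∀ j, p ∈ closure (M j))
    (hdist : ∀ j k, j ≠ k → A j p ≠ A k p)
    (i : Fin r) (hi : A i p ∈ (valueHull A p).extremePoints ℝ)
    (hedge : ∀ k, k ≠ i → A k p ∈ adjacentEdges (valueHull A p) (A i p) →
      A k p ∈ (valueHull A p).extremePoints ℝ) :
    ∃ g : ℂ → ℂ, LocallyIntegrableOn g U ∧
      distDz (distributionOf U (fun z => (maxHarmonic U p A z : ℂ))) = distributionOf U g ∧
      ∃ N ∈ 𝓝 p, ∀ᵐ z, z ∈ maxRegion U p A i ∩ N → Φ z = 2 * g z := by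
  have : Nonempty (Fin r) := ⟨i⟩
  have hAd : ∀ k, DifferentiableOn ℂ (A k) U := fun k => (hPA.analytic k).differentiableOn
  refine ⟨maxHarmonicDz U p A, locallyIntegrableOn_maxHarmonicDz hU p hAd,
    distDz_maxHarmonic hU p hAd, ?_⟩
  obtain ⟨K, hKp, hKU, hK⟩ := local_compact_nhds (U.isOpen.mem_nhds hp)
  have hsep : ∀ᶠ z in 𝓝 p, ∀ k, k ≠ i → A k z ≠ A i z := by
    rw [Filter.eventually_all]
    intro k
    rw [Filter.eventually_imp_distrib_left]
    intro hk
    have hc := (hPA.analytic k p hp).continuousAt.sub (hPA.analytic i p hp).continuousAt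
    exact (hc.eventually_ne (sub_ne_zero.2 (hdist k i hk))).mono fun z hz => sub_ne_zero.1 hz
  have hloc := eventually_nhdsWithin_iff.1
    (eventually_onlyPieceNear hU hPA hΦ hp (hactive i) hdist hi hedge)
  refine ⟨_, (show ∀ᶠ z in 𝓝 p, z ∈ interior K from interior_mem_nhds.2 hKp).and (hsep.and hloc), ?_⟩
  have hnp : ∀ᵐ z : ℂ, z ≠ p := measure_eq_zero_iff_ae_notMem.1 (measure_singleton p)
  filter_upwards [ae_differentiableAt_maxHarmonic hU p hAd hK hKU, hPA.ae_eq_of_mem,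
    hPA.ae_mem_piece, hnp] with z hdiff hval hmem hzp hz
  obtain ⟨⟨hzU, hzi⟩, hzK, hzsep, hzloc⟩ := hz
  have hd := hdiff hzK
  have h2 := two_mul_maxHarmonicDz hU p hAd hzU hd hzi
  -- A tie would force `A k z = 2 ∂φ/∂z = A i z`, excluded near `p`.
  have hlt : ∀ k, k ≠ i → harmonicFrom U p (A k) z < harmonicFrom U p (A i) z := by
    intro k hk
    refine lt_of_le_of_ne (hzi ▸ harmonicFrom_le_maxHarmonic p A k z) fun heq => hzsep k hk ?_
    rw [← h2, two_mul_maxHarmonicDz hU p hAd hzU hd (hzi.trans heq.symm)]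
  have honly := (hzloc hzp hlt).self_of_nhds
  obtain ⟨k, hk⟩ := hmem hzU
  have hki : k = i := by
    by_contra h
    exact honly k h hk
  rw [h2, hval k hk, hki]
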